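/- Let $\mathcal{H}$ be a separable complex Hilbert space of finite or infinite dimension, with unit sphere $\mathbb{S}(\mathcal{H})=\{\psi\in\mathcal{H}:\|\psi\|=1\}$ carrying its Borel $\sigma$-algebra, and let $\rho$ be a density matrix on $\mathcal{H}$, i.e., a positive bounded operator with $\operatorname{tr}\rho=1$. Write $\rho=\sum_n p_n|n\rangle\langle n|$ with an orthonormal basis $(|n\rangle)_n$ of eigenvectors, let $(Z_n)_n$ be independent complex random variables such that $\mathrm{Re}\,Z_n$ and $\mathrm{Im}\,Z_n$ are independent centred real Gaussians with variance $p_n/2$ each, and let $\mathrm{G}(\rho)$ be the distribution of $\sum_n Z_n|n\rangle$ on $\mathcal{H}$. Let $\mathrm{GA}(\rho)$ be the measure on $\mathcal{H}$ with density $\|\psi\|^2$ relative to $\mathrm{G}(\rho)$, and let $\mathrm{GAP}(\rho)$ be the distribution on $\mathbb{S}(\mathcal{H})$ of $\Psi/\|\Psi\|$, where $\Psi$ has distribution $\mathrm{GA}(\rho)$. Let $\eta>0$ and let $f:\mathbb{S}(\mathcal{H})\to\mathbb{R}$ satisfy $|f(\psi)-f(\phi)|\le\eta\,\arccos\mathrm{Re}\langle\psi|\phi\rangle$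 for all $\psi,\phi\in\mathbb{S}(\mathcal{H})$, i.e., $f$ is Lipschitz with constant $\eta$ in the spherical metric. Let $\varepsilon\ge 0$. Then $\mathrm{GAP}(\rho)$ is a probability measure, $f$ is $\mathrm{GAP}(\rho)$-integrable, and with $\mathrm{GAP}(\rho)(f):=\int f\,d\,\mathrm{GAP}(\rho)$ and the operator norm $\|\rho\|$, $$\mathrm{GAP}(\rho)\Bigl\{\psi\in\mathbb{S}(\mathcal{H}):\bigl|f(\psi)-\mathrm{GAP}(\rho)(f)\bigr|>\varepsilon\Bigr\}\le 6\exp\left(-\frac{C\varepsilon^2}{\eta^2\|\rho\|}\right),\qquad C=\frac{1}{288\pi^2}.$$ -/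

import Mathlib

open MeasureTheory ProbabilityTheory
open scoped NNReal ENNReal InnerProductSpace

noncomputable section

/-- A density operator (density matrix) on a complex Hilbert space: a bounded positive operator
with trace one. The trace is the unconditional sum of the diagonal matrix elements with respect to
an orthonormal basis; for positive operators it does not depend on the basis. -/
structure DensityOperator (H : Type*) [NormedAddCommGroup H] [InnerProductSpace ℂ H]
    [CompleteSpace H] where
  /-- the underlying bounded operator -/
  op : H →L[ℂ] H
  isPositive : op.IsPositive
  trace_eq_one : ∃ (w : Set H) (b : HilbertBasis w ℂ H), HasSum (fun i => ⟪b i, op (b i)⟫_ℂ) 1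

/-- An orthonormal basis of eigenvectors of an operator, with its (nonnegative) eigenvalues. -/
structure EigenONB {H : Type*} [NormedAddCommGroup H] [InnerProductSpace ℂ H]
    (T : H →L[ℂ] H) where
  /-- the index set of the basis -/
  index : Set H
  /-- the orthonormal basis -/
  basis : HilbertBasis index ℂ H
  /-- the eigenvalues -/
  eigenvalue : index → ℝ≥0
  apply_basis : ∀ n, T (basis n) = ((eigenvalue n : ℝ) : ℂ) • basis n

/-- A bounded operator whose matrix columns in some orthonormal basis are square summable
is compact. -/
theorem isCompactOperator_of_summable_sq {H : Type*} [NormedAddCommGroup H]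
    [InnerProductSpace ℂ H] [CompleteSpace H] (S : H →L[ℂ] H) {ι : Type*}
    (b : HilbertBasis ι ℂ H) (hS : Summable fun i => ‖S (b i)‖ ^ 2) : IsCompactOperator S := by
  classical
  let A : ι → H →L[ℂ] H := fun i =>
    (ContinuousLinearMap.toSpanSingleton ℂ (S (b i))).comp (innerSL ℂ (b i))
  have hA : ∀ i x, A i x = ⟪b i, x⟫_ℂ • S (b i) := fun i x => by simp [A]
  have hAc : ∀ i, A i ∈ compactOperator (RingHom.id ℂ) H H := fun i => by
    have hc : IsCompactOperator (ContinuousLinearMap.toSpanSingleton ℂ (S (b i))) :=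
      isCompactOperator_of_locallyCompactSpace_rng
        (ContinuousLinearMap.toSpanSingleton ℂ (S (b i)))
    exact hc.comp_clm (innerSL ℂ (b i))
  clear_value A
  have hbound : ∀ G : Finset ι, ‖∑ i ∈ G, A i‖ ≤ √(∑ i ∈ G, ‖S (b i)‖ ^ 2) := by
    intro G
    refine ContinuousLinearMap.opNorm_le_bound _ (Real.sqrt_nonneg _) fun x => ?_
    rw [sum_apply]
    calc ‖∑ i ∈ G, A i x‖ ≤ ∑ i ∈ G, ‖⟪b i, x⟫_ℂ‖ * ‖S (b i)‖ := by
          refine (norm_sum_le _ _).trans (Finset.sum_le_sum fun i _ => ?_)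
          rw [hA, norm_smul]
      _ ≤ √(∑ i ∈ G, ‖⟪b i, x⟫_ℂ‖ ^ 2) * √(∑ i ∈ G, ‖S (b i)‖ ^ 2) :=
          Real.sum_mul_le_sqrt_mul_sqrt _ _ _
      _ ≤ ‖x‖ * √(∑ i ∈ G, ‖S (b i)‖ ^ 2) := by
          gcongr
          exact Real.sqrt_le_iff.2 ⟨norm_nonneg _, b.orthonormal.sum_inner_products_le x⟩
      _ = _ := mul_comm _ _
  have hsum : Summable A := by
    rw [summable_iff_vanishing_norm]
    intro ε hε
    obtain ⟨F, hF⟩ := summable_iff_vanishing_norm.1 hS (ε ^ 2) (by positivity)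
    refine ⟨F, fun G hG => (hbound G).trans_lt ?_⟩
    rw [Real.sqrt_lt' hε]
    exact (le_abs_self _).trans_lt (hF G hG)
  have heq : ∑' i, A i = S := by
    ext x
    let ev : (H →L[ℂ] H) →L[ℂ] H := ContinuousLinearMap.apply ℂ H x
    have h1 : HasSum (fun i => A i x) ((∑' i, A i) x) := ev.hasSum hsum.hasSum
    have h2 : HasSum (fun i => A i x) (S x) := by
      have := S.hasSum (b.hasSum_repr x)
      simpa [hA, b.repr_apply_apply] using this
    exact h1.unique h2
  refine isCompactOperator_of_tendsto (heq ▸ hsum.hasSum : HasSum A S) ?_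
  refine Filter.Eventually.of_forall fun G => ?_
  exact Submodule.sum_mem _ fun i _ => hAc i

theorem DensityOperator.isCompactOperator {H : Type*} [NormedAddCommGroup H]
    [InnerProductSpace ℂ H] [CompleteSpace H] (ρ : DensityOperator H) :
    IsCompactOperator ρ.op := by
  obtain ⟨w, b, hb⟩ := ρ.trace_eq_one
  have h0 : 0 ≤ ρ.op := (ContinuousLinearMap.nonneg_iff_isPositive _).2 ρ.isPositive
  set S := CFC.sqrt ρ.op with hSdef
  have hSS : S * S = ρ.op := CFC.sqrt_mul_sqrt_self ρ.op h0
  have hSsymm : S.IsSymmetric :=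
    ((ContinuousLinearMap.nonneg_iff_isPositive _).1 (CFC.sqrt_nonneg ρ.op)).isSymmetric
  have hS : IsCompactOperator S := by
    refine isCompactOperator_of_summable_sq S b ?_
    refine (Complex.hasSum_re hb).summable.congr fun i => ?_
    rw [← hSS]
    change (⟪b i, S (S (b i))⟫_ℂ).re = ‖S (b i)‖ ^ 2
    have := hSsymm (b i) (S (b i))
    simp only [ContinuousLinearMap.coe_coe] at this
    rw [← this, inner_self_eq_norm_sq_to_K]
    norm_cast
  rw [← hSS]
  exact hS.comp_clm S

open scoped ComplexOrder in
/-- Every density operator has an orthonormal basis of eigenvectors. -/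
theorem DensityOperator.nonempty_eigenONB {H : Type*} [NormedAddCommGroup H]
    [InnerProductSpace ℂ H] [CompleteSpace H] (ρ : DensityOperator H) :
    Nonempty (EigenONB ρ.op) := by
  classical
  let E : ℂ → Submodule ℂ H := fun μ => Module.End.eigenspace (ρ.op : Module.End ℂ H) μ
  have hcompl : ∀ μ, CompleteSpace (E μ) := fun μ => by
    have hc : IsClosed (E μ : Set H) := by
      have : (E μ : Set H) = {x | ρ.op x = μ • x} := by
        ext x; simp [E]
      rw [this]
      exact isClosed_eq ρ.op.continuous (continuous_const_smul μ)
    exact hc.completeSpace_coe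
  choose W B hB using fun μ => exists_hilbertBasis ℂ (E μ)
  have horth : OrthogonalFamily ℂ (fun μ => E μ) fun μ => (E μ).subtypeₗᵢ :=
    ρ.isPositive.isSymmetric.orthogonalFamily_eigenspaces
  let v : (Σ μ, W μ) → H := fun a => (B a.1 a.2 : H)
  have hv : Orthonormal ℂ v :=
    horth.orthonormal_sigma_orthonormal fun μ => (B μ).orthonormal
  have hbot : (Submodule.span ℂ (Set.range ((↑) : Set.range v → H)))ᗮ = ⊥ := by
    rw [Subtype.range_coe, eq_bot_iff,
      ← ContinuousLinearMap.orthogonalComplement_iSup_eigenspaces_eq_bot ρ.isCompactOperator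
        ρ.isPositive.isSymmetric, ← Submodule.iInf_orthogonal]
    intro x hx
    rw [Submodule.mem_iInf]
    intro μ
    rw [Submodule.mem_orthogonal]
    intro u hu
    have hall : ∀ i, ⟪x, (B μ i : H)⟫_ℂ = 0 := fun i =>
      Submodule.inner_left_of_mem_orthogonal
        (Submodule.subset_span (Set.mem_range_self (f := v) ⟨μ, i⟩)) hx
    have h1 := ((innerSL ℂ x).comp (E μ).subtypeL).hasSum ((B μ).hasSum_repr ⟨u, hu⟩)
    have h2 : ⟪x, u⟫_ℂ = 0 := by
      refine h1.unique ?_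
      convert hasSum_zero using 2 with i
      simp [hall]
    exact inner_eq_zero_symm.1 h2
  have hmk := HilbertBasis.coe_mkOfOrthogonalEqBot hv.toSubtypeRange hbot
  have heig : ∀ n : Set.range v, ∃ p : ℝ≥0, ρ.op n = ((p : ℝ) : ℂ) • (n : H) := by
    rintro ⟨_, ⟨⟨μ, i⟩, rfl⟩⟩
    have hx : ρ.op (v ⟨μ, i⟩) = μ • v ⟨μ, i⟩ := Module.End.mem_eigenspace_iff.1 (B μ i).2
    have hn : ‖v ⟨μ, i⟩‖ = 1 := hv.1 _
    have hpos : 0 ≤ ⟪v ⟨μ, i⟩, ρ.op (v ⟨μ, i⟩)⟫_ℂ := ρ.isPositive.inner_nonneg_right _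
    rw [hx, inner_smul_right, inner_self_eq_norm_sq_to_K, hn] at hpos
    simp only [RCLike.ofReal_one, one_pow, mul_one] at hpos
    obtain ⟨hre, him⟩ := Complex.nonneg_iff.1 hpos
    refine ⟨⟨μ.re, hre⟩, ?_⟩
    have hμ : ((μ.re : ℝ) : ℂ) = μ := Complex.ext (by simp) (by simpa using him)
    change ρ.op (v ⟨μ, i⟩) = ((μ.re : ℝ) : ℂ) • v ⟨μ, i⟩
    rw [hμ, hx]
  choose p hp using heig
  exact ⟨⟨Set.range v, HilbertBasis.mkOfOrthogonalEqBot hv.toSubtypeRange hbot, p,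
    fun n => by rw [hmk]; exact hp n⟩⟩

/-- An eigenbasis `(|n⟩)` of the density operator `ρ`, with eigenvalues `p n`. -/
def DensityOperator.eigenONB {H : Type*} [NormedAddCommGroup H] [InnerProductSpace ℂ H]
    [CompleteSpace H] (ρ : DensityOperator H) : EigenONB ρ.op :=
  Classical.choice ρ.nonempty_eigenONB

/-- The centred complex Gaussian distribution with variance `p`: real and imaginary part are
independent centred real Gaussians, each with variance `p / 2`. -/
def complexGaussian (p : ℝ≥0) : Measure ℂ :=
  ((gaussianReal 0 (p / 2)).prod (gaussianReal 0 (p / 2))).map fun z => (⟨z.1, z.2⟩ : ℂ)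

/-- The Gaussian measure `G(ρ)`: the law of `∑ₙ Zₙ |n⟩`, where the `Zₙ` are independent centred
complex Gaussians with variances the eigenvalues `p n` of `ρ`, realised as the coordinates of a
product space. -/
def gaussianMeasure {H : Type*} [NormedAddCommGroup H] [InnerProductSpace ℂ H] [CompleteSpace H]
    [MeasurableSpace H] (ρ : DensityOperator H) : Measure H :=
  (Measure.infinitePi fun n => complexGaussian (ρ.eigenONB.eigenvalue n)).map
    fun Z => ∑' n, Z n • ρ.eigenONB.basis n

/-- The adjusted Gaussian measure `GA(ρ)`, with density `‖ψ‖²` relative to `G(ρ)`. -/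
def gaMeasure {H : Type*} [NormedAddCommGroup H] [InnerProductSpace ℂ H] [CompleteSpace H]
    [MeasurableSpace H] (ρ : DensityOperator H) : Measure H :=
  (gaussianMeasure ρ).withDensity fun ψ => ENNReal.ofReal (‖ψ‖ ^ 2)

/-- The measure `GAP(ρ)` on the unit sphere: the law of `Ψ / ‖Ψ‖`, where `Ψ` has law `GA(ρ)`. -/
def gapMeasure {H : Type*} [NormedAddCommGroup H] [InnerProductSpace ℂ H] [CompleteSpace H]
    [MeasurableSpace H] (ρ : DensityOperator H) : Measure (Metric.sphere (0 : H) 1) :=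
  ((gaMeasure ρ).map fun ψ => ((‖ψ‖⁻¹ : ℝ) : ℂ) • ψ).comap ((↑) : Metric.sphere (0 : H) 1 → H)

/-- The spherical (geodesic) distance on the unit sphere. -/
def sphericalDist {H : Type*} [NormedAddCommGroup H] [InnerProductSpace ℂ H]
    (ψ φ : Metric.sphere (0 : H) 1) : ℝ :=
  Real.arccos (⟪(ψ : H), (φ : H)⟫_ℂ).re

end

/-! The measure G(ρ) satisfies a dimension-free concentration inequality. By the Maurey–Pisier
argument, `exp (F Y - F X)` has expectation at most exp(π²K²‖ρ‖/16) for K-Lipschitz `F` and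
independent X, Y with law G(ρ). Jensen's inequality in X then compares `F` with its mean. Only ‖ρ‖
enters, because each real coordinate of the Gaussian vector has variance at most ‖ρ‖/2. The
finite-dimensional case passes to the series by Fatou's lemma.

The normalisation ψ/‖ψ‖ is not Lipschitz near the origin, so `f` is transferred to the Hilbert space
through the one-homogeneous function F(ψ) = ‖ψ‖(f(ψ/‖ψ‖) - m - ε), where m is the GAP mean. This
function is globally Lipschitz, and nonnegative wherever `f` exceeds m + ε. Its Gaussian mean is at
most -ε/2: f - m has mean zero with weight ‖ψ‖², and replacing that weight by ‖ψ‖ costs little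
because E(‖ψ‖ - 1)² ≤ 6‖ρ‖, itself a consequence of concentration and tr ρ = 1.

A Chernoff bound for tF + 2‖ψ‖ yields one tail; the term 2‖ψ‖ absorbs the density ‖ψ‖². The other
tail follows by replacing `f` with `-f`. For ε too small for this argument the bound exceeds 1, and
for ε > πη the event is empty. -/

/-! ### Maurey–Pisier concentration for Gaussian measures. -/

/-- Jensen's inequality for the exponential function, without integrability of `exp ∘ g`. -/
theorem ofReal_exp_integral_le_lintegral {Ω : Type*} [MeasurableSpace Ω] {μ : Measure Ω}
    [IsProbabilityMeasure μ] {g : Ω → ℝ} (hg : Integrable g μ) :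
    ENNReal.ofReal (Real.exp (∫ x, g x ∂μ)) ≤ ∫⁻ x, ENNReal.ofReal (Real.exp (g x)) ∂μ := by
  by_cases htop : ∫⁻ x, ENNReal.ofReal (Real.exp (g x)) ∂μ = ⊤
  · simp [htop]
  have hmeas : AEStronglyMeasurable (fun x => Real.exp (g x)) μ :=
    Real.continuous_exp.comp_aestronglyMeasurable hg.aestronglyMeasurable
  have hint : Integrable (fun x => Real.exp (g x)) μ :=
    (lintegral_ofReal_ne_top_iff_integrable hmeas (ae_of_all _ fun _ => (Real.exp_pos _).le)).1 htop
  rw [← ofReal_integral_eq_lintegral_ofReal hint (ae_of_all _ fun _ => (Real.exp_pos _).le)]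
  exact ENNReal.ofReal_le_ofReal (convexOn_exp.map_integral_le Real.continuous_exp.continuousOn
    isClosed_univ (ae_of_all _ fun _ => Set.mem_univ _) hg hint)

open scoped Convolution ContDiff in
/-- A Lipschitz function on a finite-dimensional space is a uniform limit of continuously
differentiable functions with the same Lipschitz constant. -/
theorem LipschitzWith.exists_contDiff_dist_le {E : Type*} [NormedAddCommGroup E] [NormedSpace ℝ E]
    [FiniteDimensional ℝ E] {K : ℝ≥0} {g : E → ℝ} (hg : LipschitzWith K g) {δ : ℝ} (hδ : 0 < δ) :
    ∃ h : E → ℝ, ContDiff ℝ 1 h ∧ LipschitzWith K h ∧ ∀ x, |h x - g x| ≤ δ := by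
  borelize E
  -- Mollifying at scale r moves `g` by at most K r; the 1 in the denominator covers K = 0.
  obtain ⟨r, hr, hr'⟩ : ∃ r : ℝ, 0 < r ∧ K * r ≤ δ :=
    ⟨δ / (K + 1), by positivity, by
      rw [mul_div_assoc', div_le_iff₀ (by positivity)]; nlinarith [K.coe_nonneg]⟩
  let φ : ContDiffBump (0 : E) := ⟨r / 2, r, half_pos hr, half_lt_self hr⟩
  let μ : Measure E := Measure.addHaar
  have hli : LocallyIntegrable g μ := hg.continuous.locallyIntegrable
  have hex : ∀ x, ConvolutionExistsAt (φ.normed μ) g x (ContinuousLinearMap.lsmul ℝ ℝ) μ :=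
    fun x => (φ.hasCompactSupport_normed.convolutionExists_left _ φ.continuous_normed hli) x
  refine ⟨φ.normed μ ⋆[ContinuousLinearMap.lsmul ℝ ℝ, μ] g, ?_, ?_, fun x => ?_⟩
  · exact φ.hasCompactSupport_normed.contDiff_convolution_left _ φ.contDiff_normed hli
  · refine LipschitzWith.of_dist_le_mul fun x y => ?_
    rw [Real.dist_eq, convolution_def, convolution_def, ← integral_sub (hex x) (hex y),
      ← Real.norm_eq_abs]
    calc ‖∫ t, (ContinuousLinearMap.lsmul ℝ ℝ (φ.normed μ t) (g (x - t))
            - ContinuousLinearMap.lsmul ℝ ℝ (φ.normed μ t) (g (y - t))) ∂μ‖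
        ≤ ∫ t, φ.normed μ t * (K * dist x y) ∂μ := by
          refine norm_integral_le_of_norm_le (φ.integrable_normed.mul_const _)
            (ae_of_all _ fun t => ?_)
          have := hg.dist_le_mul (x - t) (y - t)
          rw [dist_sub_right, Real.dist_eq] at this
          simp only [ContinuousLinearMap.lsmul_apply, smul_eq_mul, ← mul_sub, norm_mul,
            Real.norm_eq_abs, abs_of_nonneg (φ.nonneg_normed t)]
          exact mul_le_mul_of_nonneg_left this (φ.nonneg_normed t)
      _ = K * dist x y := by rw [integral_mul_const, φ.integral_normed, one_mul]
  · rw [← Real.dist_eq]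
    refine φ.dist_normed_convolution_le hg.continuous.aestronglyMeasurable fun y hy => ?_
    refine (hg.dist_le_mul y x).trans (le_trans ?_ hr')
    exact mul_le_mul_of_nonneg_left (Metric.mem_ball.1 hy).le K.coe_nonneg

/-- The exponential moment of a centred Gaussian functional. -/
theorem lintegral_exp_dual_le {E : Type*} [NormedAddCommGroup E] [NormedSpace ℝ E]
    [CompleteSpace E] [SecondCountableTopology E] [MeasurableSpace E] [BorelSpace E]
    {μ : Measure E} [IsGaussian μ]
    (hμ : μ[id] = 0) {v : ℝ} (hv : ∀ L : StrongDual ℝ E, Var[L; μ] ≤ v * ‖L‖ ^ 2)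
    (L : StrongDual ℝ E) :
    ∫⁻ x, ENNReal.ofReal (Real.exp (L x)) ∂μ ≤ ENNReal.ofReal (Real.exp (v * ‖L‖ ^ 2 / 2)) := by
  have hL0 : μ[L] = 0 := by
    simp only [id_eq] at hμ
    simp [IsGaussian.integral_dual, hμ]
  have hmap : μ.map L = gaussianReal 0 Var[L; μ].toNNReal := by
    rw [IsGaussian.map_eq_gaussianReal, hL0]
  have hint : Integrable (fun x => Real.exp (L x)) μ := by
    have h1 := integrable_exp_mul_gaussianReal (μ := 0) (v := Var[L; μ].toNNReal) 1
    rw [← hmap] at h1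
    simpa [Function.comp_def] using (integrable_map_measure (by fun_prop) (by fun_prop)).1 h1
  rw [← ofReal_integral_eq_lintegral_ofReal hint (ae_of_all _ fun _ => (Real.exp_pos _).le)]
  refine ENNReal.ofReal_le_ofReal ?_
  have h2 := mgf_gaussianReal hmap 1
  simp only [mgf, one_mul, zero_add, one_pow, mul_one] at h2
  rw [h2, Real.coe_toNNReal _ (variance_nonneg _ _)]
  have := hv L
  gcongr

/-- Maurey–Pisier inequality for a continuously differentiable Lipschitz function. -/
theorem lintegral_exp_sub_le_of_contDiff {E : Type*} [NormedAddCommGroup E] [NormedSpace ℝ E]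
    [CompleteSpace E] [SecondCountableTopology E] [MeasurableSpace E] [BorelSpace E]
    {μ : Measure E} [IsGaussian μ] (hμ : μ[id] = 0) {v : ℝ} (hv0 : 0 ≤ v)
    (hv : ∀ L : StrongDual ℝ E, Var[L; μ] ≤ v * ‖L‖ ^ 2) {K : ℝ≥0} {g : E → ℝ}
    (hgc : ContDiff ℝ 1 g) (hg : LipschitzWith K g) :
    ∫⁻ z, ENNReal.ofReal (Real.exp (g z.2 - g z.1)) ∂(μ.prod μ)
      ≤ ENNReal.ofReal (Real.exp (Real.pi ^ 2 * K ^ 2 * v / 8)) := by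
  -- Rotation by θ sends (X, Y) to (cos θ X + sin θ Y, -sin θ X + cos θ Y). The second component is
  -- the θ-derivative of the first, so `D` is the derivative of `g` along a path from X to Y.
  let D : ℝ → E × E → ℝ := fun θ z =>
    fderiv ℝ g (ContinuousLinearMap.rotation θ z).1 (ContinuousLinearMap.rotation θ z).2
  have hpi := Real.pi_pos
  have hfc : Continuous (fderiv ℝ g) := hgc.continuous_fderiv (by simp)
  have hDc : Continuous fun y : (E × E) × ℝ => D y.2 y.1 := by
    simp only [D, ContinuousLinearMap.rotation_apply]
    fun_prop
  have hDz : ∀ z, Continuous fun θ => D θ z := fun z => by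
    simp only [D, ContinuousLinearMap.rotation_apply]
    fun_prop
  -- Uniform probability on (0, π/2], so that Jensen's inequality moves the exponential inside the
  -- θ-integral. The factor π/2 in `hftc` undoes the normalisation.
  let ν : Measure ℝ := (ENNReal.ofReal (2 / Real.pi)) • volume.restrict (Set.Ioc 0 (Real.pi / 2))
  have hνp : IsProbabilityMeasure ν := ⟨by
    simp only [ν, Measure.smul_apply, Measure.restrict_apply_univ, Real.volume_Ioc, smul_eq_mul,
      sub_zero]
    rw [← ENNReal.ofReal_mul (by positivity)]
    field_simp
    simp⟩
  have hftc : ∀ z : E × E, ∫ θ, (Real.pi / 2) * D θ z ∂ν = g z.2 - g z.1 := by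
    intro z
    have hderiv : ∀ θ ∈ Set.uIcc 0 (Real.pi / 2),
        HasDerivAt (fun θ => g (ContinuousLinearMap.rotation θ z).1) (D θ z) θ := by
      intro θ _
      have h1 : HasDerivAt (fun θ : ℝ => (ContinuousLinearMap.rotation θ z).1)
          (ContinuousLinearMap.rotation θ z).2 θ := by
        simp only [ContinuousLinearMap.rotation_apply]
        have ha : HasDerivAt (fun θ : ℝ => Real.cos θ • z.1) (-Real.sin θ • z.1) θ :=
          (Real.hasDerivAt_cos θ).smul_const z.1
        have hb : HasDerivAt (fun θ : ℝ => Real.sin θ • z.2) (Real.cos θ • z.2) θ :=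
          (Real.hasDerivAt_sin θ).smul_const z.2
        exact ha.fun_add hb
      exact ((hgc.differentiable (by simp)) _).hasFDerivAt.comp_hasDerivAt θ h1
    have h2 := intervalIntegral.integral_eq_sub_of_hasDerivAt hderiv
      ((hDz z).intervalIntegrable _ _)
    simp only [ν, integral_smul_measure, integral_const_mul]
    rw [← intervalIntegral.integral_of_le (by positivity), h2,
      ENNReal.toReal_ofReal (by positivity)]
    simp only [ContinuousLinearMap.rotation_apply, smul_eq_mul, Real.cos_pi_div_two,
      Real.sin_pi_div_two, Real.cos_zero, Real.sin_zero, zero_smul, one_smul, zero_add, add_zero]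
    field_simp
  have hint : ∀ z : E × E, Integrable (fun θ => (Real.pi / 2) * D θ z) ν := by
    intro z
    refine Integrable.const_mul (Integrable.smul_measure ?_ ENNReal.ofReal_ne_top) _
    exact (hDz z).integrableOn_Icc.mono_set Set.Ioc_subset_Icc_self
  have hmeas : Measurable fun y : (E × E) × ℝ => ENNReal.ofReal (Real.exp (Real.pi / 2 * D y.2 y.1)) :=
    (ENNReal.continuous_ofReal.comp (Real.continuous_exp.comp (hDc.const_mul _))).measurable
  calc ∫⁻ z, ENNReal.ofReal (Real.exp (g z.2 - g z.1)) ∂(μ.prod μ)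
      ≤ ∫⁻ z, ∫⁻ θ, ENNReal.ofReal (Real.exp (Real.pi / 2 * D θ z)) ∂ν ∂(μ.prod μ) := by
        refine lintegral_mono fun z => ?_
        rw [← hftc z]
        exact ofReal_exp_integral_le_lintegral (hint z)
    _ = ∫⁻ θ, ∫⁻ z, ENNReal.ofReal (Real.exp (Real.pi / 2 * D θ z)) ∂(μ.prod μ) ∂ν :=
        lintegral_lintegral_swap hmeas.aemeasurable
    _ ≤ ∫⁻ _θ, ENNReal.ofReal (Real.exp (Real.pi ^ 2 * K ^ 2 * v / 8)) ∂ν := by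
        refine lintegral_mono fun θ => ?_
        -- By rotation invariance the rotated pair is again independent with law μ. For fixed x, y ↦
        -- (π/2) g'(x) y is then centred Gaussian with variance at most (π/2)²K²v, half of which is
        -- the exponent.
        have hm : Measurable fun y : E × E =>
            ENNReal.ofReal (Real.exp (Real.pi / 2 * fderiv ℝ g y.1 y.2)) := by
          refine Continuous.measurable ?_
          exact ENNReal.continuous_ofReal.comp (Real.continuous_exp.comp (by fun_prop))
        have h1 := lintegral_map (μ := μ.prod μ) hm
          (ContinuousLinearMap.rotation (E := E) θ).continuous.measurable
        rw [IsGaussian.map_rotation_eq_self hμ] at h1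
        refine (le_of_eq h1.symm).trans ?_
        rw [lintegral_prod _ hm.aemeasurable]
        calc ∫⁻ x, ∫⁻ y, ENNReal.ofReal (Real.exp (Real.pi / 2 * fderiv ℝ g x y)) ∂μ ∂μ
            ≤ ∫⁻ _x, ENNReal.ofReal (Real.exp (Real.pi ^ 2 * K ^ 2 * v / 8)) ∂μ := by
              refine lintegral_mono fun x => ?_
              refine (lintegral_exp_dual_le hμ hv ((Real.pi / 2) • fderiv ℝ g x)).trans ?_
              refine ENNReal.ofReal_le_ofReal (Real.exp_le_exp.2 ?_)
              have hK : ‖fderiv ℝ g x‖ ≤ K := norm_fderiv_le_of_lipschitz ℝ hg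
              rw [norm_smul, Real.norm_eq_abs, abs_of_pos (by positivity), mul_pow]
              have : ‖fderiv ℝ g x‖ ^ 2 ≤ (K : ℝ) ^ 2 := by gcongr
              have h3 : v * Real.pi ^ 2 * ‖fderiv ℝ g x‖ ^ 2 ≤ v * Real.pi ^ 2 * (K : ℝ) ^ 2 := by
                gcongr
              linarith
          _ = _ := by simp
    _ = _ := by simp

/-- Maurey–Pisier inequality for Lipschitz functions of a finite-dimensional centred Gaussian
vector. -/
theorem lintegral_exp_sub_le_of_lipschitz {E : Type*} [NormedAddCommGroup E] [NormedSpace ℝ E]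
    [FiniteDimensional ℝ E] [MeasurableSpace E] [BorelSpace E]
    {μ : Measure E} [IsGaussian μ] (hμ : μ[id] = 0) {v : ℝ} (hv0 : 0 ≤ v)
    (hv : ∀ L : StrongDual ℝ E, Var[L; μ] ≤ v * ‖L‖ ^ 2) {K : ℝ≥0} {g : E → ℝ}
    (hg : LipschitzWith K g) :
    ∫⁻ z, ENNReal.ofReal (Real.exp (g z.2 - g z.1)) ∂(μ.prod μ)
      ≤ ENNReal.ofReal (Real.exp (Real.pi ^ 2 * K ^ 2 * v / 8)) := by
  have : CompleteSpace E := FiniteDimensional.complete ℝ E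
  have : SecondCountableTopology E := by
    have := FiniteDimensional.proper ℝ E
    infer_instance
  -- The approximation error δ occurs at both points, hence 2δ.
  have hδ : ∀ δ : ℝ, 0 < δ → ∫⁻ z, ENNReal.ofReal (Real.exp (g z.2 - g z.1)) ∂(μ.prod μ)
      ≤ ENNReal.ofReal (Real.exp (2 * δ + Real.pi ^ 2 * K ^ 2 * v / 8)) := by
    intro δ hδ
    obtain ⟨h, hc, hl, hh⟩ := hg.exists_contDiff_dist_le hδ
    rw [Real.exp_add, ENNReal.ofReal_mul (Real.exp_pos _).le]
    refine le_trans ?_ (mul_le_mul_right (lintegral_exp_sub_le_of_contDiff hμ hv0 hv hc hl) _)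
    rw [← lintegral_const_mul' _ _ ENNReal.ofReal_ne_top]
    refine lintegral_mono fun z => ?_
    rw [← ENNReal.ofReal_mul (Real.exp_pos _).le, ← Real.exp_add]
    refine ENNReal.ofReal_le_ofReal (Real.exp_le_exp.2 ?_)
    have h1 := abs_le.1 (hh z.1)
    have h2 := abs_le.1 (hh z.2)
    linarith
  have hcont : Continuous fun δ : ℝ =>
      ENNReal.ofReal (Real.exp (2 * δ + Real.pi ^ 2 * K ^ 2 * v / 8)) :=
    ENNReal.continuous_ofReal.comp (by fun_prop)
  have hlim := (hcont.tendsto 0).mono_left (nhdsWithin_le_nhds (s := Set.Ioi 0))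
  simp only [mul_zero, zero_add] at hlim
  exact ge_of_tendsto hlim (by filter_upwards [self_mem_nhdsWithin] with δ h using hδ δ h)

/-! ### Complex Gaussians and their finite products. -/

theorem complexGaussian_eq_map (p : ℝ≥0) :
    complexGaussian p = ((gaussianReal 0 (p / 2)).prod (gaussianReal 0 (p / 2))).map
      (Complex.equivRealProdCLM.symm : ℝ × ℝ →L[ℝ] ℂ) := by
  unfold complexGaussian
  congr 1

instance isGaussian_complexGaussian (p : ℝ≥0) : IsGaussian (complexGaussian p) := by
  rw [complexGaussian_eq_map]
  infer_instance

theorem variance_dual_complexGaussian (p : ℝ≥0) (L : StrongDual ℝ ℂ) :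
    Var[L; complexGaussian p] = (L 1 ^ 2 + L Complex.I ^ 2) * (p / 2) := by
  rw [complexGaussian_eq_map, variance_map (by fun_prop) (by fun_prop)]
  have h : (L ∘ (Complex.equivRealProdCLM.symm : ℝ × ℝ →L[ℝ] ℂ)) =
      fun x : ℝ × ℝ => L 1 * id x.1 + L Complex.I * id x.2 := by
    ext x
    have hx : (x.1 + x.2 * Complex.I : ℂ) = x.1 • (1 : ℂ) + x.2 • Complex.I := by simp
    simp only [Function.comp_apply, ContinuousLinearEquiv.coe_coe,
      Complex.equivRealProdCLM_symm_apply, hx, map_add, map_smul, smul_eq_mul, id]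
    ring
  rw [h, variance_add_prod (X := fun x => L 1 * id x) (Y := fun x => L Complex.I * id x)
    (IsGaussian.memLp_two_id.const_mul _) (IsGaussian.memLp_two_id.const_mul _)]
  simp only [variance_const_mul, variance_id_gaussianReal]
  push_cast
  ring

theorem integral_dual_complexGaussian (p : ℝ≥0) (L : StrongDual ℝ ℂ) :
    ∫ z, L z ∂(complexGaussian p) = 0 := by
  rw [complexGaussian_eq_map, integral_map (by fun_prop) (by fun_prop)]
  have h : ∀ x : ℝ × ℝ, L ((Complex.equivRealProdCLM.symm : ℝ × ℝ →L[ℝ] ℂ) x) =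
      L 1 * x.1 + L Complex.I * x.2 := by
    intro x
    have hx : (x.1 + x.2 * Complex.I : ℂ) = x.1 • (1 : ℂ) + x.2 • Complex.I := by simp
    simp only [ContinuousLinearEquiv.coe_coe,
      Complex.equivRealProdCLM_symm_apply, hx, map_add, map_smul, smul_eq_mul]
    ring
  have hi : Integrable (fun x : ℝ => x) (gaussianReal 0 (p / 2)) := IsGaussian.integrable_id
  simp only [h]
  rw [integral_add ((hi.comp_fst _).const_mul _) ((hi.comp_snd _).const_mul _),
    integral_const_mul, integral_const_mul, integral_fun_fst (fun x : ℝ => x), integral_fun_snd (fun x : ℝ => x)]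
  simp

theorem integral_id_complexGaussian (p : ℝ≥0) : ∫ z, z ∂(complexGaussian p) = 0 := by
  refine (SeparatingDual.eq_zero_iff_forall_dual_eq_zero (R := ℝ) _).2 fun L => ?_
  rw [← IsGaussian.integral_dual, integral_dual_complexGaussian]

theorem lintegral_enorm_sq_complexGaussian (p : ℝ≥0) :
    ∫⁻ z, ENNReal.ofReal (‖z‖ ^ 2) ∂(complexGaussian p) = p := by
  have hsq : ∀ L : StrongDual ℝ ℂ,
      ∫ z, L z ^ 2 ∂(complexGaussian p) = (L 1 ^ 2 + L Complex.I ^ 2) * (p / 2) := by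
    intro L
    rw [← variance_dual_complexGaussian, variance_of_integral_eq_zero (by fun_prop)
      (integral_dual_complexGaussian p L)]
  have hint : ∀ L : StrongDual ℝ ℂ, Integrable (fun z => L z ^ 2) (complexGaussian p) :=
    fun L => (IsGaussian.memLp_dual _ L 2 (by simp)).integrable_sq
  have hn : ∀ z : ℂ, ‖z‖ ^ 2 = Complex.reCLM z ^ 2 + Complex.imCLM z ^ 2 := by
    intro z
    rw [Complex.sq_norm, Complex.normSq_apply, Complex.reCLM_apply, Complex.imCLM_apply, sq, sq]
  simp only [hn]
  rw [← ofReal_integral_eq_lintegral_ofReal ((hint Complex.reCLM).fun_add (hint Complex.imCLM))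
    (ae_of_all _ fun z => by simp only [Pi.zero_apply]; positivity),
    integral_add (hint _) (hint _), hsq, hsq]
  simp

/-- The identification of `ι → ℂ` with a Euclidean space, as a real linear map. -/
noncomputable def piToEuclidean (ι : Type*) [Fintype ι] : (ι → ℂ) →L[ℝ] EuclideanSpace ℂ ι :=
  ((PiLp.continuousLinearEquiv 2 ℝ fun _ : ι => ℂ).symm : (ι → ℂ) →L[ℝ] EuclideanSpace ℂ ι)

theorem piToEuclidean_apply {ι : Type*} [Fintype ι] (x : ι → ℂ) :
    piToEuclidean ι x = WithLp.toLp 2 x := rfl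

/-- The product of complex Gaussians, as a measure on a Euclidean space. -/
noncomputable def euclideanComplexGaussian {ι : Type*} [Fintype ι] (p : ι → ℝ≥0) :
    Measure (EuclideanSpace ℂ ι) :=
  (Measure.pi fun i => complexGaussian (p i)).map
    (piToEuclidean ι)

theorem isGaussian_pi_complexGaussian {ι : Type*} [Fintype ι] (p : ι → ℝ≥0) :
    IsGaussian (Measure.pi fun i => complexGaussian (p i)) := by
  have h1 : ∀ i, HasGaussianLaw (fun ω : ι → ℂ => ω i)
      (Measure.pi fun i => complexGaussian (p i)) := fun i =>
    ⟨by rw [(measurePreserving_eval _ i).map_eq]; infer_instance⟩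
  have h2 := (iIndepFun.hasGaussianLaw h1 (iIndepFun_pi (X := fun _ => id)
    fun _ => aemeasurable_id)).isGaussian_map
  simpa [Measure.map_id'] using h2

instance isGaussian_euclideanComplexGaussian {ι : Type*} [Fintype ι] (p : ι → ℝ≥0) :
    IsGaussian (euclideanComplexGaussian p) := by
  have := isGaussian_pi_complexGaussian p
  unfold euclideanComplexGaussian
  infer_instance

theorem integral_id_euclideanComplexGaussian {ι : Type*} [Fintype ι] (p : ι → ℝ≥0) :
    ∫ x, id x ∂(euclideanComplexGaussian p) = 0 := by
  have := isGaussian_pi_complexGaussian p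
  rw [euclideanComplexGaussian, integral_map (by fun_prop) (by fun_prop)]
  simp only [id]
  rw [ContinuousLinearMap.integral_comp_comm _ IsGaussian.integrable_fun_id]
  have h0 : ∫ x, x ∂(Measure.pi fun i => complexGaussian (p i)) = 0 := by
    ext i
    rw [eval_integral (fun i => integrable_eval IsGaussian.integrable_id)]
    have := integral_map (μ := Measure.pi fun i => complexGaussian (p i)) (φ := fun x : ι → ℂ => x i)
      (measurable_pi_apply i).aemeasurable (f := fun z => z) (by fun_prop)
    rw [← this, (measurePreserving_eval _ i).map_eq, integral_id_complexGaussian]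
    rfl
  simp [h0]

/-- By independence the variance is a weighted sum of squares of the values of `L` at the real basis
vectors, with weights p i / 2. The unweighted sum is at most ‖L‖². -/
theorem variance_dual_euclideanComplexGaussian_le {ι : Type*} [Fintype ι] {p : ι → ℝ≥0} {P : ℝ}
    (hp : ∀ i, (p i : ℝ) ≤ P) (hP : 0 ≤ P) (L : StrongDual ℝ (EuclideanSpace ℂ ι)) :
    Var[L; euclideanComplexGaussian p] ≤ P / 2 * ‖L‖ ^ 2 := by
  classical
  let A : ι → StrongDual ℝ ℂ := fun i => L ∘L
    ((piToEuclidean ι) ∘L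
      (ContinuousLinearMap.single ℝ (fun _ : ι => ℂ) i))
  have hLA : ∀ x : ι → ℂ, L ((piToEuclidean ι) x) = ∑ i, A i (x i) := by
    intro x
    simp only [A, ContinuousLinearMap.comp_apply, ← map_sum]
    congr 2
    simp [Finset.univ_sum_single]
  have hvar : Var[L; euclideanComplexGaussian p] =
      ∑ i, (A i 1 ^ 2 + A i Complex.I ^ 2) * (p i / 2) := by
    rw [euclideanComplexGaussian, variance_map (by fun_prop) (by fun_prop)]
    have h : (L ∘ (piToEuclidean ι)) = ∑ i, fun x : ι → ℂ => A i (x i) := by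
      ext x
      simp only [Function.comp_apply, hLA, Finset.sum_apply]
    rw [h, variance_sum_pi fun i => IsGaussian.memLp_dual _ (A i) 2 (by simp)]
    simp only [variance_dual_complexGaussian]
  set s : ℝ := ∑ i, (A i 1 ^ 2 + A i Complex.I ^ 2) with hs
  have hs0 : 0 ≤ s := by positivity
  have hsL : s ≤ ‖L‖ ^ 2 := by
    -- The Riesz vector of `L` for the real inner product: L w = ‖w‖² = s, so ‖w‖ ≤ ‖L‖.
    let w : ι → ℂ := fun i => ⟨A i 1, A i Complex.I⟩
    have hA : ∀ i, A i (w i) = A i 1 ^ 2 + A i Complex.I ^ 2 := by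
      intro i
      have : w i = (A i 1) • (1 : ℂ) + (A i Complex.I) • Complex.I := by
        apply Complex.ext <;> simp [w]
      rw [this, map_add, map_smul, map_smul, smul_eq_mul, smul_eq_mul]
      ring
    have h1 : L (WithLp.toLp 2 w) = s := by
      have := hLA w
      simp only [hA] at this
      exact this
    have h2 : ‖(WithLp.toLp 2 w : EuclideanSpace ℂ ι)‖ ^ 2 = s := by
      rw [EuclideanSpace.norm_sq_eq, hs]
      refine Finset.sum_congr rfl fun i _ => ?_
      rw [Complex.sq_norm, Complex.normSq_apply, sq, sq]
    have h3 := (le_abs_self _).trans (L.le_opNorm (WithLp.toLp 2 w))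
    rw [h1] at h3
    have h4 := norm_nonneg (WithLp.toLp 2 w : EuclideanSpace ℂ ι)
    have h5 : ‖(WithLp.toLp 2 w : EuclideanSpace ℂ ι)‖ ≤ ‖L‖ := by
      rcases h4.eq_or_lt with h | h
      · rw [← h]; exact norm_nonneg _
      · nlinarith
    rw [← h2]
    gcongr
  rw [hvar]
  calc ∑ i, (A i 1 ^ 2 + A i Complex.I ^ 2) * (p i / 2 : ℝ)
      ≤ ∑ i, (A i 1 ^ 2 + A i Complex.I ^ 2) * (P / 2) := by
        gcongr with i
        exact hp i
    _ = P / 2 * s := by rw [← Finset.sum_mul, mul_comm]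
    _ ≤ P / 2 * ‖L‖ ^ 2 := by gcongr

/-! ### Hilbert bases, eigenvalues and the trace. -/

/-- Distinct basis vectors are at distance √2, so balls of radius 1/2 around them are disjoint.
Countability is what makes the random series measurable and allows sums and integrals to be
exchanged. -/
theorem HilbertBasis.countable_of_separableSpace {H : Type*} [NormedAddCommGroup H]
    [InnerProductSpace ℂ H] [TopologicalSpace.SeparableSpace H] {ι : Type*}
    (b : HilbertBasis ι ℂ H) : Countable ι := by
  rw [← Set.countable_univ_iff]
  refine Set.PairwiseDisjoint.countable_of_isOpen (s := fun i => Metric.ball (b i) (1 / 2)) ?_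
    (fun i _ => Metric.isOpen_ball) (fun i _ => ⟨b i, by simp⟩)
  intro i _ j _ hij
  refine Metric.ball_disjoint_ball ?_
  have h : dist (b i) (b j) ^ 2 = 2 := by
    rw [dist_eq_norm, norm_sub_sq (𝕜 := ℂ), b.orthonormal.1, b.orthonormal.1, b.orthonormal.2 hij]
    norm_num
  nlinarith [dist_nonneg (x := b i) (y := b j)]

theorem EigenONB.eigenvalue_le_norm {H : Type*} [NormedAddCommGroup H] [InnerProductSpace ℂ H]
    {T : H →L[ℂ] H} (e : EigenONB T) (n : e.index) : (e.eigenvalue n : ℝ) ≤ ‖T‖ := by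
  have h := T.le_opNorm (e.basis n)
  rw [e.apply_basis, norm_smul, e.basis.orthonormal.1] at h
  simpa using h

theorem HilbertBasis.tsum_ofReal_norm_inner_sq {H : Type*} [NormedAddCommGroup H]
    [InnerProductSpace ℂ H] {ι : Type*} (b : HilbertBasis ι ℂ H) (x : H) :
    ∑' i, ENNReal.ofReal (‖⟪b i, x⟫_ℂ‖ ^ 2) = ENNReal.ofReal (‖x‖ ^ 2) := by
  have h := Complex.hasSum_re (b.hasSum_inner_mul_inner x x)
  have h1 : ∀ i, (⟪x, b i⟫_ℂ * ⟪b i, x⟫_ℂ).re = ‖⟪b i, x⟫_ℂ‖ ^ 2 := by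
    intro i
    rw [← inner_conj_symm, Complex.conj_mul']
    norm_cast
  have h2 : (⟪x, x⟫_ℂ).re = ‖x‖ ^ 2 := by
    rw [inner_self_eq_norm_sq_to_K]
    norm_cast
  simp only [h1, h2] at h
  rw [← ENNReal.ofReal_tsum_of_nonneg (fun i => by positivity) h.summable, h.tsum_eq]

/-- The eigenvalues of a density operator sum up to one. -/
theorem DensityOperator.tsum_eigenvalue {H : Type*} [NormedAddCommGroup H] [InnerProductSpace ℂ H]
    [CompleteSpace H] (ρ : DensityOperator H) (e : EigenONB ρ.op) :
    ∑' n, (e.eigenvalue n : ℝ≥0∞) = 1 := by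
  obtain ⟨w, b, hb⟩ := ρ.trace_eq_one
  have hre := Complex.hasSum_re hb
  have hterm : ∀ i, HasSum (fun n => (e.eigenvalue n : ℝ) * ‖⟪e.basis n, b i⟫_ℂ‖ ^ 2)
      (⟪b i, ρ.op (b i)⟫_ℂ).re := by
    intro i
    have h := Complex.hasSum_re (e.basis.hasSum_inner_mul_inner (b i) (ρ.op (b i)))
    convert h using 2 with n
    have hs : ⟪e.basis n, ρ.op (b i)⟫_ℂ = (e.eigenvalue n : ℝ) * ⟪e.basis n, b i⟫_ℂ := by
      have := ρ.isPositive.isSymmetric (e.basis n) (b i)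
      simp only [ContinuousLinearMap.coe_coe] at this
      rw [← this, e.apply_basis, inner_smul_left, Complex.conj_ofReal]
    rw [hs, mul_left_comm, ← inner_conj_symm (b i), Complex.conj_mul']
    norm_cast
  have hnn : ∀ i, 0 ≤ (⟪b i, ρ.op (b i)⟫_ℂ).re := fun i =>
    (hterm i).nonneg fun n => by positivity
  -- The trace is given in a basis `b` unrelated to the eigenbasis. Parseval in `b`, Tonelli, and
  -- Parseval in the eigenbasis carry one sum into the other.
  calc ∑' n, (e.eigenvalue n : ℝ≥0∞)
      = ∑' n, ∑' i, (e.eigenvalue n : ℝ≥0∞) * ENNReal.ofReal (‖⟪e.basis n, b i⟫_ℂ‖ ^ 2) := by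
        refine tsum_congr fun n => ?_
        rw [ENNReal.tsum_mul_left]
        have := b.tsum_ofReal_norm_inner_sq (e.basis n)
        simp only [norm_inner_symm (b _), e.basis.orthonormal.1] at this
        rw [this]
        simp
    _ = ∑' i, ∑' n, (e.eigenvalue n : ℝ≥0∞) * ENNReal.ofReal (‖⟪e.basis n, b i⟫_ℂ‖ ^ 2) :=
        ENNReal.tsum_comm
    _ = ∑' i, ENNReal.ofReal (⟪b i, ρ.op (b i)⟫_ℂ).re := by
        refine tsum_congr fun i => ?_
        rw [← (hterm i).tsum_eq, ENNReal.ofReal_tsum_of_nonneg (fun n => by positivity)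
          (hterm i).summable]
        refine tsum_congr fun n => ?_
        rw [ENNReal.ofReal_mul (by positivity), ENNReal.ofReal_coe_nnreal]
    _ = 1 := by
        rw [← ENNReal.ofReal_tsum_of_nonneg hnn hre.summable, hre.tsum_eq]
        simp

theorem DensityOperator.norm_pos {H : Type*} [NormedAddCommGroup H] [InnerProductSpace ℂ H]
    [CompleteSpace H] (ρ : DensityOperator H) : 0 < ‖ρ.op‖ := by
  by_contra h
  have h0 : ‖ρ.op‖ = 0 := le_antisymm (not_lt.1 h) (norm_nonneg _)
  have hp := ρ.tsum_eigenvalue ρ.eigenONB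
  have h1 : ∀ n, ρ.eigenONB.eigenvalue n = 0 := fun n => by
    have := ρ.eigenONB.eigenvalue_le_norm n
    rw [h0] at this
    exact le_antisymm (by exact_mod_cast this) zero_le
  simp [h1] at hp

/-! ### Gaussian series in a Hilbert space. -/

section RandomSeries

variable {H : Type*} [NormedAddCommGroup H] [InnerProductSpace ℂ H]
  {ι : Type*} (b : HilbertBasis ι ℂ H)

/-- A square summable sequence of coefficients has a sum, whose norm is given by Parseval. -/
theorem HilbertBasis.hasSum_smul_of_tsum_ne_top {z : ι → ℂ}
    (hz : ∑' n, ENNReal.ofReal (‖z n‖ ^ 2) ≠ ⊤) :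
    HasSum (fun n => z n • b n) (∑' n, z n • b n) ∧
      ENNReal.ofReal (‖∑' n, z n • b n‖ ^ 2) = ∑' n, ENNReal.ofReal (‖z n‖ ^ 2) := by
  have hs : Summable fun n => ‖z n‖ ^ 2 := by
    have := ENNReal.summable_toReal hz
    refine this.congr fun n => ?_
    rw [ENNReal.toReal_ofReal (by positivity)]
  have hmem : Memℓp z 2 := memℓp_gen (by simpa using hs)
  have hsum := (b.hasSum_repr_symm ⟨z, hmem⟩).summable.hasSum
  change HasSum (fun n => z n • b n) (∑' n, z n • b n) at hsum
  refine ⟨hsum, ?_⟩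
  rw [← b.tsum_ofReal_norm_inner_sq]
  refine tsum_congr fun n => ?_
  have h1 := (innerSL ℂ (b n)).hasSum hsum
  have h2 : HasSum (fun k => innerSL ℂ (b n) (z k • b k)) (z n) := by
    classical
    convert hasSum_single n ?_ using 1
    · simp [b.orthonormal.1]
    · intro k hk
      simp [b.orthonormal.2 hk.symm]
  have h3 := h1.unique h2
  rw [innerSL_apply_apply] at h3
  rw [h3]

variable (p : ι → ℝ≥0)

theorem measurable_ofReal_norm_sq_apply (n : ι) :
    Measurable fun Z : ι → ℂ => ENNReal.ofReal (‖Z n‖ ^ 2) :=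
  ((measurable_pi_apply n).norm.pow_const 2).ennreal_ofReal

theorem lintegral_tsum_norm_sq_infinitePi [Countable ι] :
    ∫⁻ Z, ∑' n, ENNReal.ofReal (‖Z n‖ ^ 2) ∂(Measure.infinitePi fun n => complexGaussian (p n))
      = ∑' n, (p n : ℝ≥0∞) := by
  rw [lintegral_tsum fun n => (measurable_ofReal_norm_sq_apply n).aemeasurable]
  refine tsum_congr fun n => ?_
  rw [← lintegral_enorm_sq_complexGaussian (p n), ← Measure.infinitePi_map_eval
    (fun n => complexGaussian (p n)) n, lintegral_map (by fun_prop) (by fun_prop)]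

/-- The expectation of ∑ |Zₙ|² is ∑ pₙ < ∞, so the coefficients are almost surely square summable.
Thus the default value 0 of a divergent `tsum` occurs only on a null set. -/
theorem ae_hasSum_smul_infinitePi [Countable ι] (hp : ∑' n, (p n : ℝ≥0∞) ≠ ⊤) :
    ∀ᵐ Z ∂(Measure.infinitePi fun n => complexGaussian (p n)),
      HasSum (fun n => Z n • b n) (∑' n, Z n • b n) ∧
      ENNReal.ofReal (‖∑' n, Z n • b n‖ ^ 2) = ∑' n, ENNReal.ofReal (‖Z n‖ ^ 2) := by
  rw [← lintegral_tsum_norm_sq_infinitePi p] at hp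
  filter_upwards [ae_lt_top' (AEMeasurable.tsum fun n =>
    (measurable_ofReal_norm_sq_apply n).aemeasurable) hp] with Z hZ
  exact b.hasSum_smul_of_tsum_ne_top hZ.ne

theorem map_restrict_infinitePi_complexGaussian (S : Finset ι) :
    (Measure.infinitePi fun n => complexGaussian (p n)).map
        (fun Z => piToEuclidean S (S.restrict Z))
      = euclideanComplexGaussian fun n : S => p n := by
  have h := Measure.infinitePi_map_restrict (fun n => complexGaussian (p n)) (I := S)
  rw [euclideanComplexGaussian, ← h, Measure.map_map (by fun_prop) (by fun_prop)]
  rfl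

/-- Exponential moments of Lipschitz functions of a finite Gaussian sum. -/
theorem lintegral_exp_sub_le_finset_sum {P : ℝ} (hP : ∀ n, (p n : ℝ) ≤ P) (hP0 : 0 ≤ P)
    (S : Finset ι) {K : ℝ≥0} {F : H → ℝ} (hF : LipschitzWith K F) :
    ∫⁻ w, ENNReal.ofReal (Real.exp (F (∑ n ∈ S, w.2 n • b n) - F (∑ n ∈ S, w.1 n • b n)))
        ∂((Measure.infinitePi fun n => complexGaussian (p n)).prod
          (Measure.infinitePi fun n => complexGaussian (p n)))
      ≤ ENNReal.ofReal (Real.exp (K ^ 2 * (Real.pi ^ 2 * P / 16))) := by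
  let g : EuclideanSpace ℂ S → ℝ := fun v => F (∑ n, v n • b n)
  have hnorm : ∀ v : EuclideanSpace ℂ S, ‖∑ n, v n • b n‖ = ‖v‖ := by
    intro v
    have h := (b.orthonormal.comp (fun n : S => (n : ι)) Subtype.val_injective).inner_sum v v
      Finset.univ
    have h2 : ‖∑ n, v n • b n‖ ^ 2 = ‖v‖ ^ 2 := by
      simp only [Function.comp_apply] at h
      rw [inner_self_eq_norm_sq_to_K] at h
      simp only [Complex.conj_mul'] at h
      rw [EuclideanSpace.norm_sq_eq]
      exact Complex.ofReal_injective (by simpa using h)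
    exact (sq_eq_sq₀ (norm_nonneg _) (norm_nonneg _)).1 h2
  have hg : LipschitzWith K g := by
    refine LipschitzWith.of_dist_le_mul fun v w => ?_
    refine (hF.dist_le_mul _ _).trans (le_of_eq ?_)
    rw [dist_eq_norm, dist_eq_norm, ← hnorm (v - w), ← Finset.sum_sub_distrib]
    simp [sub_smul]
  have hmp := lintegral_exp_sub_le_of_lipschitz (integral_id_euclideanComplexGaussian fun n : S => p n)
    (v := P / 2) (by positivity)
    (variance_dual_euclideanComplexGaussian_le (fun n : S => hP n) hP0) hg
  have hgm : Measurable g := hg.continuous.measurable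
  rw [← map_restrict_infinitePi_complexGaussian, Measure.map_prod_map _ _ (by fun_prop)
    (by fun_prop), lintegral_map (by fun_prop) (by fun_prop)] at hmp
  refine le_trans (le_of_eq ?_) (hmp.trans (le_of_eq ?_))
  · refine lintegral_congr fun w => ?_
    simp only [g, Prod.map_fst, Prod.map_snd, piToEuclidean_apply, Finset.restrict]
    rw [← Finset.sum_coe_sort S, ← Finset.sum_coe_sort S]
  · congr 2
    ring

variable [TopologicalSpace.SeparableSpace H] [MeasurableSpace H] [BorelSpace H]

theorem measurable_tsum_smul_basis [CompleteSpace H] [Countable ι] :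
    Measurable fun Z : ι → ℂ => ∑' n, Z n • b n := by
  have : SecondCountableTopology H := UniformSpace.secondCountable_of_separable H
  exact Measurable.tsum fun n => by fun_prop

/-- Exponential moments of Lipschitz functions of a Gaussian series. -/
theorem lintegral_exp_sub_le_tsum [Countable ι] {P : ℝ} (hP : ∀ n, (p n : ℝ) ≤ P) (hP0 : 0 ≤ P)
    (hp : ∑' n, (p n : ℝ≥0∞) ≠ ⊤) {K : ℝ≥0} {F : H → ℝ} (hF : LipschitzWith K F) :
    ∫⁻ w, ENNReal.ofReal (Real.exp (F (∑' n, w.2 n • b n) - F (∑' n, w.1 n • b n)))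
        ∂((Measure.infinitePi fun n => complexGaussian (p n)).prod
          (Measure.infinitePi fun n => complexGaussian (p n)))
      ≤ ENNReal.ofReal (Real.exp (K ^ 2 * (Real.pi ^ 2 * P / 16))) := by
  have : SecondCountableTopology H := UniformSpace.secondCountable_of_separable H
  set μ := Measure.infinitePi fun n => complexGaussian (p n)
  -- Fatou's lemma needs a sequence, so the net of finite partial sums is replaced by a cofinal
  -- sequence.
  obtain ⟨S, hS⟩ := Filter.exists_seq_tendsto (Filter.atTop : Filter (Finset ι))
  have hae := ae_hasSum_smul_infinitePi b p hp
  have h1 : ∀ᵐ w ∂(μ.prod μ), HasSum (fun n => w.1 n • b n) (∑' n, w.1 n • b n) :=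
    Measure.quasiMeasurePreserving_fst.ae (hae.mono fun _ h => h.1)
  have h2 : ∀ᵐ w ∂(μ.prod μ), HasSum (fun n => w.2 n • b n) (∑' n, w.2 n • b n) :=
    Measure.quasiMeasurePreserving_snd.ae (hae.mono fun _ h => h.1)
  have hFc := hF.continuous
  let Φ : ℕ → (ι → ℂ) × (ι → ℂ) → ℝ≥0∞ := fun k w =>
    ENNReal.ofReal (Real.exp (F (∑ n ∈ S k, w.2 n • b n) - F (∑ n ∈ S k, w.1 n • b n)))
  have hΦm : ∀ k, Measurable (Φ k) := fun k => by
    have := hFc.measurable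
    fun_prop
  calc _ = ∫⁻ w, Filter.liminf (fun k => Φ k w) Filter.atTop ∂(μ.prod μ) := by
        refine lintegral_congr_ae ?_
        filter_upwards [h1, h2] with w hw1 hw2
        refine (Filter.Tendsto.liminf_eq ?_).symm
        refine (ENNReal.continuous_ofReal.comp Real.continuous_exp).continuousAt.tendsto.comp ?_
        exact ((hFc.tendsto _).comp (hw2.comp hS)).sub ((hFc.tendsto _).comp (hw1.comp hS))
    _ ≤ Filter.liminf (fun k => ∫⁻ w, Φ k w ∂(μ.prod μ)) Filter.atTop := lintegral_liminf_le hΦm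
    _ ≤ _ := by
        refine Filter.liminf_le_of_le (by isBoundedDefault) fun a ha => ?_
        obtain ⟨k, hk⟩ := ha.exists
        exact hk.trans (lintegral_exp_sub_le_finset_sum b p hP hP0 (S k) hF)

end RandomSeries

/-! ### The measure G(ρ): concentration and moments of the norm. -/

section GaussianMeasure

variable {H : Type*} [NormedAddCommGroup H] [InnerProductSpace ℂ H] [CompleteSpace H]
  [TopologicalSpace.SeparableSpace H] [MeasurableSpace H] [BorelSpace H] (ρ : DensityOperator H)

instance isProbabilityMeasure_gaussianMeasure : IsProbabilityMeasure (gaussianMeasure ρ) := by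
  have := ρ.eigenONB.basis.countable_of_separableSpace
  exact Measure.isProbabilityMeasure_map
    (measurable_tsum_smul_basis ρ.eigenONB.basis).aemeasurable

/-- Parseval turns the left side into ∑ pₙ = tr ρ. This is why GA(ρ) has total mass one. -/
theorem lintegral_norm_sq_gaussianMeasure :
    ∫⁻ ψ, ENNReal.ofReal (‖ψ‖ ^ 2) ∂(gaussianMeasure ρ) = 1 := by
  have := ρ.eigenONB.basis.countable_of_separableSpace
  have hp := ρ.tsum_eigenvalue ρ.eigenONB
  rw [gaussianMeasure, lintegral_map (by fun_prop) (measurable_tsum_smul_basis ρ.eigenONB.basis),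
    ← hp, ← lintegral_tsum_norm_sq_infinitePi]
  refine lintegral_congr_ae ?_
  filter_upwards [ae_hasSum_smul_infinitePi ρ.eigenONB.basis ρ.eigenONB.eigenvalue
    (by simp [hp])] with Z hZ using hZ.2

theorem lintegral_exp_sub_gaussianMeasure_le {K : ℝ≥0} {F : H → ℝ} (hF : LipschitzWith K F) :
    ∫⁻ ψ, ∫⁻ φ, ENNReal.ofReal (Real.exp (F φ - F ψ)) ∂(gaussianMeasure ρ) ∂(gaussianMeasure ρ)
      ≤ ENNReal.ofReal (Real.exp (K ^ 2 * (Real.pi ^ 2 * ‖ρ.op‖ / 16))) := by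
  have : SecondCountableTopology H := UniformSpace.secondCountable_of_separable H
  have := ρ.eigenONB.basis.countable_of_separableSpace
  have hp := ρ.tsum_eigenvalue ρ.eigenONB
  have hX := measurable_tsum_smul_basis ρ.eigenONB.basis
  have hFm := hF.continuous.measurable
  have hm : Measurable fun w : H × H => ENNReal.ofReal (Real.exp (F w.2 - F w.1)) := by fun_prop
  have h := lintegral_exp_sub_le_tsum ρ.eigenONB.basis ρ.eigenONB.eigenvalue
    ρ.eigenONB.eigenvalue_le_norm (norm_nonneg _) (by simp [hp]) hF
  refine le_trans (le_of_eq ?_) h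
  rw [← lintegral_prod (fun w : H × H => ENNReal.ofReal (Real.exp (F w.2 - F w.1)))
    hm.aemeasurable, gaussianMeasure, Measure.map_prod_map _ _ hX hX,
    lintegral_map hm (hX.prodMap hX)]
  rfl

theorem memLp_norm_gaussianMeasure : MemLp (fun ψ : H => ‖ψ‖) 2 (gaussianMeasure ρ) := by
  have : SecondCountableTopology H := UniformSpace.secondCountable_of_separable H
  rw [memLp_two_iff_integrable_sq (by fun_prop)]
  refine (lintegral_ofReal_ne_top_iff_integrable (by fun_prop)
    (ae_of_all _ fun _ => by simp only [Pi.zero_apply]; positivity)).1 ?_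
  rw [lintegral_norm_sq_gaussianMeasure]
  simp

theorem integral_norm_sq_gaussianMeasure : ∫ ψ, ‖ψ‖ ^ 2 ∂(gaussianMeasure ρ) = 1 := by
  have h := ofReal_integral_eq_lintegral_ofReal (memLp_norm_gaussianMeasure ρ).integrable_sq
    (ae_of_all _ fun _ => by simp only [Pi.zero_apply]; positivity)
  rw [lintegral_norm_sq_gaussianMeasure] at h
  simpa using h

theorem LipschitzWith.integrable_gaussianMeasure {K : ℝ≥0} {F : H → ℝ} (hF : LipschitzWith K F) :
    Integrable F (gaussianMeasure ρ) := by
  have : SecondCountableTopology H := UniformSpace.secondCountable_of_separable H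
  have h1 : Integrable (fun ψ : H => |F 0| + K * ‖ψ‖) (gaussianMeasure ρ) :=
    (integrable_const _).add (((memLp_norm_gaussianMeasure ρ).integrable (by norm_num)).const_mul _)
  refine h1.mono' hF.continuous.aestronglyMeasurable (ae_of_all _ fun ψ => ?_)
  have h2 := hF.dist_le_mul ψ 0
  rw [Real.dist_eq, dist_zero_right] at h2
  have h3 := abs_sub_abs_le_abs_sub (F ψ) (F 0)
  rw [Real.norm_eq_abs]
  linarith

/-- Gaussian concentration: Lipschitz functions are sub-Gaussian under `G(ρ)`. -/
theorem lintegral_exp_sub_integral_gaussianMeasure_le {K : ℝ≥0} {F : H → ℝ}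
    (hF : LipschitzWith K F) :
    ∫⁻ φ, ENNReal.ofReal (Real.exp (F φ - ∫ ψ, F ψ ∂(gaussianMeasure ρ))) ∂(gaussianMeasure ρ)
      ≤ ENNReal.ofReal (Real.exp (K ^ 2 * (Real.pi ^ 2 * ‖ρ.op‖ / 16))) := by
  have : SecondCountableTopology H := UniformSpace.secondCountable_of_separable H
  have hFm := hF.continuous.measurable
  refine le_trans ?_ (lintegral_exp_sub_gaussianMeasure_le ρ hF)
  -- With φ fixed, Jensen's inequality in the independent copy ψ replaces F ψ by its mean.
  rw [lintegral_lintegral_swap (by fun_prop)]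
  refine lintegral_mono fun φ => ?_
  have hi : Integrable (fun ψ => F φ - F ψ) (gaussianMeasure ρ) :=
    (integrable_const _).sub (hF.integrable_gaussianMeasure ρ)
  refine le_trans (le_of_eq ?_) (ofReal_exp_integral_le_lintegral hi)
  rw [integral_sub (integrable_const _) (hF.integrable_gaussianMeasure ρ)]
  simp

/-- The variance of the norm under `G(ρ)` is of the order of the largest eigenvalue of `ρ`. -/
theorem integral_sub_integral_sq_norm_le :
    ∫ ψ, (‖ψ‖ - ∫ φ, ‖φ‖ ∂(gaussianMeasure ρ)) ^ 2 ∂(gaussianMeasure ρ) ≤ 3 * ‖ρ.op‖ := by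
  have : SecondCountableTopology H := UniformSpace.secondCountable_of_separable H
  have hP := ρ.norm_pos
  set G := gaussianMeasure ρ
  set c := ∫ φ, ‖φ‖ ∂G with hc
  set κ := Real.pi ^ 2 * ‖ρ.op‖ / 16 with hκ
  have hpi := Real.pi_pos
  have hκ0 : 0 < κ := by positivity
  -- This scale makes the exponential moment bound exp(t²κ) equal to e, for both signs of the
  -- exponent.
  set t := √κ⁻¹ with ht
  have ht0 : 0 < t := by positivity
  have ht2 : t ^ 2 * κ = 1 := by rw [ht, Real.sq_sqrt (by positivity), inv_mul_cancel₀ hκ0.ne']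
  have hlip : ∀ s : ℝ, |s| = t → LipschitzWith t.toNNReal fun ψ : H => s * ‖ψ‖ := by
    intro s hs
    refine LipschitzWith.of_dist_le_mul fun x y => ?_
    rw [Real.coe_toNNReal _ ht0.le, Real.dist_eq, ← mul_sub, abs_mul, hs, dist_eq_norm]
    exact mul_le_mul_of_nonneg_left (abs_norm_sub_norm_le x y) ht0.le
  have hexp : ∀ s : ℝ, |s| = t → Integrable (fun ψ : H => Real.exp (s * (‖ψ‖ - c))) G ∧
      ∫ ψ, Real.exp (s * (‖ψ‖ - c)) ∂G ≤ Real.exp 1 := by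
    intro s hs
    have h := lintegral_exp_sub_integral_gaussianMeasure_le ρ (hlip s hs)
    rw [Real.coe_toNNReal _ ht0.le, ht2, integral_const_mul] at h
    simp only [← mul_sub] at h
    have hi : Integrable (fun ψ : H => Real.exp (s * (‖ψ‖ - c))) G :=
      (lintegral_ofReal_ne_top_iff_integrable (by fun_prop)
        (ae_of_all _ fun _ => (Real.exp_pos _).le)).1 (ne_top_of_le_ne_top ENNReal.ofReal_ne_top h)
    refine ⟨hi, ?_⟩
    rw [← ofReal_integral_eq_lintegral_ofReal hi (ae_of_all _ fun _ => (Real.exp_pos _).le)] at h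
    exact (ENNReal.ofReal_le_ofReal_iff (Real.exp_pos _).le).1 h
  obtain ⟨hi1, hb1⟩ := hexp t (abs_of_pos ht0)
  obtain ⟨hi2, hb2⟩ := hexp (-t) (by rw [abs_neg, abs_of_pos ht0])
  -- The right side is 4 sinh²(x/2).
  have hsq : ∀ x : ℝ, x ^ 2 ≤ Real.exp x + Real.exp (-x) - 2 := by
    intro x
    have h1 : |x| / 2 ≤ Real.sinh (|x| / 2) := Real.self_le_sinh_iff.2 (by positivity)
    have h2 : (|x| / 2) ^ 2 ≤ Real.sinh (|x| / 2) ^ 2 := by gcongr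
    have h3 : Real.cosh x = 2 * Real.sinh (|x| / 2) ^ 2 + 1 := by
      rw [← Real.cosh_abs, show |x| = 2 * (|x| / 2) by ring, Real.cosh_two_mul, Real.cosh_sq]
      ring_nf
    rw [div_pow, sq_abs] at h2
    rw [Real.cosh_eq] at h3
    linarith
  have hii : Integrable (fun ψ : H => (‖ψ‖ - c) ^ 2) G :=
    ((memLp_norm_gaussianMeasure ρ).sub (memLp_const c)).integrable_sq
  have hmain : t ^ 2 * ∫ ψ, (‖ψ‖ - c) ^ 2 ∂G ≤ 2 * Real.exp 1 - 2 := by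
    rw [← integral_const_mul]
    calc ∫ ψ, t ^ 2 * (‖ψ‖ - c) ^ 2 ∂G
        ≤ ∫ ψ, (Real.exp (t * (‖ψ‖ - c)) + Real.exp (-t * (‖ψ‖ - c)) - 2) ∂G := by
          refine integral_mono (hii.const_mul _) ((hi1.add hi2).sub (integrable_const _)) fun ψ => ?_
          have := hsq (t * (‖ψ‖ - c))
          rw [mul_pow] at this
          simpa only [neg_mul] using this
      _ = ∫ ψ, Real.exp (t * (‖ψ‖ - c)) ∂G + ∫ ψ, Real.exp (-t * (‖ψ‖ - c)) ∂G - 2 := by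
          rw [integral_sub (hi1.fun_add hi2) (integrable_const _), integral_add hi1 hi2]
          simp
      _ ≤ _ := by linarith
  have he := Real.exp_one_lt_d9
  have h2 : ∫ ψ, (‖ψ‖ - c) ^ 2 ∂G ≤ κ * (2 * Real.exp 1 - 2) := by
    have := mul_le_mul_of_nonneg_left hmain hκ0.le
    rwa [← mul_assoc, mul_comm κ, ht2, one_mul] at this
  refine h2.trans ?_
  have hpi2 : Real.pi ^ 2 < 10 := by nlinarith [Real.pi_lt_d2, Real.pi_gt_three]
  calc κ * (2 * Real.exp 1 - 2) ≤ κ * 4 := by gcongr; linarith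
    _ ≤ 3 * ‖ρ.op‖ := by rw [hκ]; nlinarith

theorem integral_norm_sub_sq_gaussianMeasure (a : ℝ) :
    ∫ ψ, (‖ψ‖ - a) ^ 2 ∂(gaussianMeasure ρ)
      = 1 - 2 * a * ∫ ψ, ‖ψ‖ ∂(gaussianMeasure ρ) + a ^ 2 := by
  have hi1 : Integrable (fun ψ : H => 2 * a * ‖ψ‖) (gaussianMeasure ρ) :=
    ((memLp_norm_gaussianMeasure ρ).integrable (by norm_num)).const_mul _
  have hi2 : Integrable (fun ψ : H => ‖ψ‖ ^ 2) (gaussianMeasure ρ) :=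
    (memLp_norm_gaussianMeasure ρ).integrable_sq
  have hi3 : Integrable (fun ψ : H => ‖ψ‖ ^ 2 - 2 * a * ‖ψ‖) (gaussianMeasure ρ) := hi2.sub hi1
  have h : ∀ ψ : H, (‖ψ‖ - a) ^ 2 = ‖ψ‖ ^ 2 - 2 * a * ‖ψ‖ + a ^ 2 := fun ψ => by ring
  simp only [h]
  rw [integral_add hi3 (integrable_const _), integral_sub hi2 hi1, integral_const_mul,
    integral_norm_sq_gaussianMeasure ρ]
  simp

/-- With c = E‖ψ‖, the variance bound reads 1 - c² ≤ 3‖ρ‖, and 0 ≤ E(‖ψ‖ - 1)² = 2 - 2c gives c ≤ 1.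
Hence 1 - c ≤ 1 - c². -/
theorem one_sub_le_integral_norm_gaussianMeasure :
    1 - 3 * ‖ρ.op‖ ≤ ∫ ψ, ‖ψ‖ ∂(gaussianMeasure ρ) := by
  have h1 := integral_sub_integral_sq_norm_le ρ
  have h0 : 0 ≤ ∫ ψ, (‖ψ‖ - 1) ^ 2 ∂(gaussianMeasure ρ) := integral_nonneg fun ψ => by positivity
  have hc0 : 0 ≤ ∫ φ, ‖φ‖ ∂(gaussianMeasure ρ) := integral_nonneg fun ψ => norm_nonneg ψ
  rw [integral_norm_sub_sq_gaussianMeasure] at h0 h1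
  nlinarith

theorem integral_norm_sub_one_sq_gaussianMeasure_le :
    ∫ ψ, (‖ψ‖ - 1) ^ 2 ∂(gaussianMeasure ρ) ≤ 6 * ‖ρ.op‖ := by
  have h1 := one_sub_le_integral_norm_gaussianMeasure ρ
  rw [integral_norm_sub_sq_gaussianMeasure]
  linarith

end GaussianMeasure

/-! ### Geometry of the sphere and the one-homogeneous extension. -/

theorem sphericalDist_le_pi {H : Type*} [NormedAddCommGroup H] [InnerProductSpace ℂ H]
    (ψ φ : Metric.sphere (0 : H) 1) : sphericalDist ψ φ ≤ Real.pi :=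
  Real.arccos_le_pi _

/-- The chord of an arc θ is 2 sin(θ/2), and sin x ≥ 2x/π on [0, π/2]. -/
theorem sphericalDist_le_norm_sub {H : Type*} [NormedAddCommGroup H] [InnerProductSpace ℂ H]
    (ψ φ : Metric.sphere (0 : H) 1) : sphericalDist ψ φ ≤ Real.pi / 2 * ‖(ψ : H) - φ‖ := by
  have hψ : ‖(ψ : H)‖ = 1 := by simp
  have hφ : ‖(φ : H)‖ = 1 := by simp
  have habs : |(⟪(ψ : H), (φ : H)⟫_ℂ).re| ≤ 1 := by
    have h := (Complex.abs_re_le_norm _).trans (norm_inner_le_norm (𝕜 := ℂ) (ψ : H) (φ : H))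
    rwa [hψ, hφ, one_mul] at h
  have hns : ‖(ψ : H) - φ‖ ^ 2 = 2 - 2 * (⟪(ψ : H), (φ : H)⟫_ℂ).re := by
    rw [norm_sub_sq (𝕜 := ℂ), hψ, hφ]
    simp only [RCLike.re_to_complex]
    ring
  obtain ⟨h1, h2⟩ := abs_le.1 habs
  have hcos : Real.cos (sphericalDist ψ φ) = (⟪(ψ : H), (φ : H)⟫_ℂ).re := Real.cos_arccos h1 h2
  have h0 : 0 ≤ sphericalDist ψ φ := Real.arccos_nonneg _
  have hle := sphericalDist_le_pi ψ φ
  set θ := sphericalDist ψ φ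
  have hsin : 2 / Real.pi * (θ / 2) ≤ Real.sin (θ / 2) :=
    Real.mul_le_sin (by linarith) (by linarith)
  have hhalf : Real.cos θ = 1 - 2 * Real.sin (θ / 2) ^ 2 := by
    rw [show θ = 2 * (θ / 2) by ring, Real.cos_two_mul, Real.cos_sq']
    ring_nf
  have hpi := Real.pi_pos
  have hs0 : 0 ≤ Real.sin (θ / 2) := Real.sin_nonneg_of_nonneg_of_le_pi (by linarith) (by linarith)
  have heq : ‖(ψ : H) - φ‖ = 2 * Real.sin (θ / 2) := by
    rw [← sq_eq_sq₀ (norm_nonneg _) (by positivity), hns, ← hcos, hhalf]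
    ring
  rw [heq]
  calc θ = Real.pi / 2 * (2 * (2 / Real.pi * (θ / 2))) := by field_simp
    _ ≤ _ := by gcongr

/-- The vector inside, scaled by ‖φ‖, is (ψ - φ) + (‖φ‖ - ‖ψ‖) ψ/‖ψ‖, and each summand has norm at
most ‖ψ - φ‖. The prefactor compensates for the blow-up of the normalisation at the origin. -/
theorem norm_mul_norm_normalize_sub_le {E : Type*} [NormedAddCommGroup E] [NormedSpace ℂ E]
    {ψ φ : E} (hψ : ψ ≠ 0) (hφ : φ ≠ 0) :
    ‖φ‖ * ‖((‖ψ‖⁻¹ : ℝ) : ℂ) • ψ - ((‖φ‖⁻¹ : ℝ) : ℂ) • φ‖ ≤ 2 * ‖ψ - φ‖ := by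
  have hψ' : (‖ψ‖ : ℂ) ≠ 0 := by simpa using hψ
  have hφ' : (‖φ‖ : ℂ) ≠ 0 := by simpa using hφ
  have h1 : ((‖φ‖ : ℝ) : ℂ) • (((‖ψ‖⁻¹ : ℝ) : ℂ) • ψ - ((‖φ‖⁻¹ : ℝ) : ℂ) • φ)
      = (ψ - φ) + (((‖φ‖ - ‖ψ‖ : ℝ) : ℂ) * ((‖ψ‖⁻¹ : ℝ) : ℂ)) • ψ := by
    rw [smul_sub, smul_smul, smul_smul]
    push_cast
    rw [mul_inv_cancel₀ hφ', sub_mul, mul_inv_cancel₀ hψ', sub_smul, one_smul, one_smul]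
    abel
  have h2 := congrArg norm h1
  rw [norm_smul, Complex.norm_real, norm_norm] at h2
  rw [h2]
  refine (norm_add_le _ _).trans ?_
  rw [norm_smul, norm_mul, Complex.norm_real, Complex.norm_real, norm_inv, norm_norm, mul_assoc,
    inv_mul_cancel₀ (by simpa using hψ), mul_one, Real.norm_eq_abs]
  have h3 := abs_norm_sub_norm_le φ ψ
  rw [norm_sub_rev] at h3
  linarith

open Classical in
/-- The radial projection to the unit sphere, with the value `s₀` at the origin. -/
noncomputable def toSphere {H : Type*} [NormedAddCommGroup H] [NormedSpace ℂ H]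
    (s₀ : Metric.sphere (0 : H) 1) (ψ : H) : Metric.sphere (0 : H) 1 :=
  if h : ψ = 0 then s₀ else ⟨((‖ψ‖⁻¹ : ℝ) : ℂ) • ψ, by
    rw [mem_sphere_zero_iff_norm, norm_smul, Complex.norm_real, norm_inv, norm_norm,
      inv_mul_cancel₀ (norm_ne_zero_iff.2 h)]⟩

theorem coe_toSphere {H : Type*} [NormedAddCommGroup H] [NormedSpace ℂ H]
    (s₀ : Metric.sphere (0 : H) 1) {ψ : H} (h : ψ ≠ 0) :
    (toSphere s₀ ψ : H) = ((‖ψ‖⁻¹ : ℝ) : ℂ) • ψ := by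
  simp [toSphere, h]

theorem measurable_toSphere {H : Type*} [NormedAddCommGroup H] [NormedSpace ℂ H]
    [SecondCountableTopology H] [MeasurableSpace H] [BorelSpace H] (s₀ : Metric.sphere (0 : H) 1) :
    Measurable (toSphere s₀) := by
  classical
  rw [← (MeasurableEmbedding.subtype_coe
    (Metric.isClosed_sphere (x := (0 : H)) (ε := 1)).measurableSet).measurable_comp_iff]
  have h : ((↑) : Metric.sphere (0 : H) 1 → H) ∘ toSphere s₀ =
      fun ψ => if ψ = 0 then (s₀ : H) else ((‖ψ‖⁻¹ : ℝ) : ℂ) • ψ := by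
    ext ψ
    by_cases hψ : ψ = 0 <;> simp [toSphere, hψ]
  rw [h]
  refine Measurable.ite (measurableSet_singleton 0) measurable_const ?_
  fun_prop

section Lipschitz

variable {H : Type*} [NormedAddCommGroup H] [InnerProductSpace ℂ H]
  {f : Metric.sphere (0 : H) 1 → ℝ} {η : ℝ}

theorem abs_sub_le_pi_mul (hη : 0 < η) (hf : ∀ ψ φ, |f ψ - f φ| ≤ η * sphericalDist ψ φ)
    (ψ φ : Metric.sphere (0 : H) 1) : |f ψ - f φ| ≤ Real.pi * η := by
  rw [mul_comm]
  exact (hf ψ φ).trans (mul_le_mul_of_nonneg_left (sphericalDist_le_pi ψ φ) hη.le)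

theorem continuous_of_sphericalDist (hη : 0 < η)
    (hf : ∀ ψ φ, |f ψ - f φ| ≤ η * sphericalDist ψ φ) : Continuous f := by
  have hpi := Real.pi_pos
  refine (LipschitzWith.of_dist_le_mul (K := (η * (Real.pi / 2)).toNNReal)
    fun ψ φ => ?_).continuous
  rw [Real.dist_eq, Subtype.dist_eq, dist_eq_norm, Real.coe_toNNReal _ (by positivity), mul_assoc]
  exact (hf ψ φ).trans (mul_le_mul_of_nonneg_left (sphericalDist_le_norm_sub ψ φ) hη.le)

/-- The one-homogeneous extension of a bounded Lipschitz function on the sphere is Lipschitz. -/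
theorem lipschitzWith_norm_mul_comp_toSphere (hη : 0 < η)
    (hf : ∀ ψ φ, |f ψ - f φ| ≤ η * sphericalDist ψ φ) (s₀ : Metric.sphere (0 : H) 1) {c M : ℝ}
    (hM : ∀ ψ, |f ψ - c| ≤ M) :
    LipschitzWith (M + Real.pi * η).toNNReal fun ψ : H => ‖ψ‖ * (f (toSphere s₀ ψ) - c) := by
  have hpi := Real.pi_pos
  have hM0 : 0 ≤ M := (abs_nonneg _).trans (hM s₀)
  refine LipschitzWith.of_dist_le_mul fun ψ φ => ?_
  rw [Real.coe_toNNReal _ (by positivity), Real.dist_eq, dist_eq_norm]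
  by_cases hψ : ψ = 0
  · rw [hψ, norm_zero, zero_mul, zero_sub, zero_sub, abs_neg, norm_neg, abs_mul, abs_norm, mul_comm]
    have := hM (toSphere s₀ φ)
    gcongr
    linarith [mul_pos hpi hη]
  -- The constant π is the arc-to-chord factor π/2 times the factor 2 from normalisation.
  have hdiff : ‖φ‖ * |f (toSphere s₀ ψ) - f (toSphere s₀ φ)| ≤ Real.pi * η * ‖ψ - φ‖ := by
    by_cases hφ : φ = 0
    · rw [hφ, norm_zero, zero_mul]
      positivity
    have h1 := (hf (toSphere s₀ ψ) (toSphere s₀ φ)).trans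
      (mul_le_mul_of_nonneg_left (sphericalDist_le_norm_sub _ _) hη.le)
    rw [coe_toSphere s₀ hψ, coe_toSphere s₀ hφ] at h1
    have h2 := mul_le_mul_of_nonneg_left h1 (norm_nonneg φ)
    have h3 := mul_le_mul_of_nonneg_left (norm_mul_norm_normalize_sub_le hψ hφ)
      (by positivity : 0 ≤ η * (Real.pi / 2))
    nlinarith
  calc |‖ψ‖ * (f (toSphere s₀ ψ) - c) - ‖φ‖ * (f (toSphere s₀ φ) - c)|
      = |(‖ψ‖ - ‖φ‖) * (f (toSphere s₀ ψ) - c)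
          + ‖φ‖ * (f (toSphere s₀ ψ) - f (toSphere s₀ φ))| := by ring_nf
    _ ≤ |‖ψ‖ - ‖φ‖| * |f (toSphere s₀ ψ) - c|
          + ‖φ‖ * |f (toSphere s₀ ψ) - f (toSphere s₀ φ)| := by
        refine (abs_add_le _ _).trans (le_of_eq ?_)
        rw [abs_mul, abs_mul, abs_norm]
    _ ≤ ‖ψ - φ‖ * M + Real.pi * η * ‖ψ - φ‖ := by
        gcongr
        · exact abs_norm_sub_norm_le ψ φ
        · exact hM _
    _ = (M + Real.pi * η) * ‖ψ - φ‖ := by ring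

end Lipschitz

/-! ### GAP(ρ) as a push-forward of GA(ρ). -/

section Gap

variable {H : Type*} [NormedAddCommGroup H] [InnerProductSpace ℂ H] [CompleteSpace H]
  [TopologicalSpace.SeparableSpace H] [MeasurableSpace H] [BorelSpace H] (ρ : DensityOperator H)

theorem ae_ne_zero_gaMeasure : ∀ᵐ ψ ∂(gaMeasure ρ), ψ ≠ 0 := by
  have : SecondCountableTopology H := UniformSpace.secondCountable_of_separable H
  rw [gaMeasure, ae_withDensity_iff (by fun_prop)]
  refine ae_of_all _ fun ψ h h0 => h ?_
  simp [h0]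

/-- The two normalisations differ only at the origin, which is GA(ρ)-null because the density ‖ψ‖²
vanishes there; hence `s₀` does not matter. -/
theorem gapMeasure_eq_map_toSphere (s₀ : Metric.sphere (0 : H) 1) :
    gapMeasure ρ = (gaMeasure ρ).map (toSphere s₀) := by
  have : SecondCountableTopology H := UniformSpace.secondCountable_of_separable H
  have hemb := MeasurableEmbedding.subtype_coe
    (Metric.isClosed_sphere (x := (0 : H)) (ε := 1)).measurableSet
  ext B hB
  rw [gapMeasure, hemb.comap_apply, Measure.map_apply (by fun_prop)
    (hemb.measurableSet_image' hB), Measure.map_apply (measurable_toSphere s₀) hB]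
  refine measure_congr ?_
  filter_upwards [ae_ne_zero_gaMeasure ρ] with ψ hψ
  refine propext ?_
  change ((‖ψ‖⁻¹ : ℝ) : ℂ) • ψ ∈ ((↑) : Metric.sphere (0 : H) 1 → H) '' B ↔ toSphere s₀ ψ ∈ B
  rw [← coe_toSphere s₀ hψ]
  exact Subtype.val_injective.mem_set_image

instance isProbabilityMeasure_gaMeasure : IsProbabilityMeasure (gaMeasure ρ) :=
  ⟨by rw [gaMeasure, withDensity_apply _ MeasurableSet.univ, setLIntegral_univ,
    lintegral_norm_sq_gaussianMeasure]⟩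

theorem gapMeasure_apply (s₀ : Metric.sphere (0 : H) 1) {B : Set (Metric.sphere (0 : H) 1)}
    (hB : MeasurableSet B) :
    gapMeasure ρ B = ∫⁻ ψ in toSphere s₀ ⁻¹' B, ENNReal.ofReal (‖ψ‖ ^ 2) ∂(gaussianMeasure ρ) := by
  have : SecondCountableTopology H := UniformSpace.secondCountable_of_separable H
  rw [gapMeasure_eq_map_toSphere ρ s₀, Measure.map_apply (measurable_toSphere s₀) hB, gaMeasure,
    withDensity_apply _ (measurable_toSphere s₀ hB)]

theorem integral_gapMeasure (s₀ : Metric.sphere (0 : H) 1) {f : Metric.sphere (0 : H) 1 → ℝ}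
    (hf : Continuous f) :
    ∫ φ, f φ ∂(gapMeasure ρ) = ∫ ψ, ‖ψ‖ ^ 2 * f (toSphere s₀ ψ) ∂(gaussianMeasure ρ) := by
  have : SecondCountableTopology H := UniformSpace.secondCountable_of_separable H
  rw [gapMeasure_eq_map_toSphere ρ s₀, integral_map (measurable_toSphere s₀).aemeasurable
    hf.measurable.aestronglyMeasurable, gaMeasure,
    integral_withDensity_eq_integral_toReal_smul (by fun_prop)
      (ae_of_all _ fun _ => ENNReal.ofReal_lt_top)]
  refine integral_congr_ae (ae_of_all _ fun ψ => ?_)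
  simp only [smul_eq_mul]
  rw [ENNReal.toReal_ofReal (by positivity)]

theorem DensityOperator.nonempty_sphere {H : Type*} [NormedAddCommGroup H]
    [InnerProductSpace ℂ H] [CompleteSpace H] (ρ : DensityOperator H) :
    Nonempty (Metric.sphere (0 : H) 1) := by
  by_contra h
  have hp := ρ.tsum_eigenvalue ρ.eigenONB
  have hemp : IsEmpty ρ.eigenONB.index :=
    ⟨fun n => h ⟨⟨ρ.eigenONB.basis n, by simp [ρ.eigenONB.basis.orthonormal.1]⟩⟩⟩
  simp at hp

end Gap

/-! ### The one-sided tail bound. -/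

section Tail

variable {H : Type*} [NormedAddCommGroup H] [InnerProductSpace ℂ H] [CompleteSpace H]
  [TopologicalSpace.SeparableSpace H] [MeasurableSpace H] [BorelSpace H] (ρ : DensityOperator H)

/-- A bounded measurable function deviates from its `‖ψ‖²`-weighted mean by at most its
oscillation. -/
theorem abs_sub_integral_norm_sq_mul_le {q : H → ℝ} (hqm : Measurable q) {B : ℝ}
    (hB : ∀ ψ φ, |q ψ - q φ| ≤ B) :
    Integrable (fun ψ => ‖ψ‖ ^ 2 * q ψ) (gaussianMeasure ρ) ∧
      ∀ ψ, |q ψ - ∫ φ, ‖φ‖ ^ 2 * q φ ∂(gaussianMeasure ρ)| ≤ B := by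
  have : SecondCountableTopology H := UniformSpace.secondCountable_of_separable H
  have hR2 : Integrable (fun ψ : H => ‖ψ‖ ^ 2) (gaussianMeasure ρ) :=
    (memLp_norm_gaussianMeasure ρ).integrable_sq
  have hint : Integrable (fun ψ => ‖ψ‖ ^ 2 * q ψ) (gaussianMeasure ρ) := by
    refine hR2.mul_bdd (c := |q 0| + B) hqm.aestronglyMeasurable (ae_of_all _ fun ψ => ?_)
    have h1 := hB ψ 0
    have h2 := abs_sub_abs_le_abs_sub (q ψ) (q 0)
    rw [Real.norm_eq_abs]
    linarith
  refine ⟨hint, fun ψ => ?_⟩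
  have h1 : q ψ - ∫ φ, ‖φ‖ ^ 2 * q φ ∂(gaussianMeasure ρ)
      = ∫ φ, ‖φ‖ ^ 2 * (q ψ - q φ) ∂(gaussianMeasure ρ) := by
    simp only [mul_sub]
    rw [integral_sub (hR2.mul_const _) hint, integral_mul_const, integral_norm_sq_gaussianMeasure,
      one_mul]
  rw [h1, ← Real.norm_eq_abs]
  calc _ ≤ ∫ φ, ‖φ‖ ^ 2 * B ∂(gaussianMeasure ρ) := by
        refine norm_integral_le_of_norm_le (hR2.mul_const _) (ae_of_all _ fun φ => ?_)
        rw [norm_mul, Real.norm_eq_abs, Real.norm_eq_abs, abs_of_nonneg (by positivity)]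
        exact mul_le_mul_of_nonneg_left (hB ψ φ) (by positivity)
    _ = B := by rw [integral_mul_const, integral_norm_sq_gaussianMeasure, one_mul]

/-- The mean of the one-homogeneous function which is positive where `q` exceeds its weighted
mean by `ε`. -/
theorem integral_norm_mul_sub_le {q : H → ℝ} (hqm : Measurable q) {B ε : ℝ}
    (hB : ∀ ψ φ, |q ψ - q φ| ≤ B) (hε : 0 < ε) (hεB : ε ≤ B)
    (hlarge : 288 * B ^ 2 * ‖ρ.op‖ ≤ ε ^ 2) :
    ∫ ψ, ‖ψ‖ * (q ψ - (∫ φ, ‖φ‖ ^ 2 * q φ ∂(gaussianMeasure ρ) + ε)) ∂(gaussianMeasure ρ)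
      ≤ -(ε / 2) := by
  have : SecondCountableTopology H := UniformSpace.secondCountable_of_separable H
  obtain ⟨hint, hbd⟩ := abs_sub_integral_norm_sq_mul_le ρ hqm hB
  have hP := ρ.norm_pos
  have hB0 : 0 < B := hε.trans_le hεB
  have hR1 : Integrable (fun ψ : H => ‖ψ‖) (gaussianMeasure ρ) :=
    (memLp_norm_gaussianMeasure ρ).integrable (by norm_num)
  have hR2 : Integrable (fun ψ : H => ‖ψ‖ ^ 2) (gaussianMeasure ρ) :=
    (memLp_norm_gaussianMeasure ρ).integrable_sq
  have hR3 : Integrable (fun ψ : H => (‖ψ‖ - 1) ^ 2) (gaussianMeasure ρ) :=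
    ((memLp_norm_gaussianMeasure ρ).sub (memLp_const 1)).integrable_sq
  have hsq := integral_norm_sub_one_sq_gaussianMeasure_le ρ
  have hc := one_sub_le_integral_norm_gaussianMeasure ρ
  have h2 := integral_norm_sq_gaussianMeasure ρ
  set G := gaussianMeasure ρ
  set m := ∫ φ, ‖φ‖ ^ 2 * q φ ∂G with hm
  -- Write ‖ψ‖(q - m) = ‖ψ‖²(q - m) + ‖ψ‖(1 - ‖ψ‖)(q - m). The first term integrates to zero by the
  -- choice of m; the second is split by the weighted AM–GM inequality, with weights whose cross
  -- term is exactly B.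
  have hpt : ∀ ψ, ‖ψ‖ * (q ψ - (m + ε)) ≤
      (‖ψ‖ ^ 2 * q ψ - m * ‖ψ‖ ^ 2) + (ε / 8 * ‖ψ‖ ^ 2 + 2 * B ^ 2 / ε * (‖ψ‖ - 1) ^ 2)
        - ε * ‖ψ‖ := by
    intro ψ
    have h1 : ‖ψ‖ * (1 - ‖ψ‖) * (q ψ - m) ≤ |‖ψ‖ * (‖ψ‖ - 1)| * B := by
      calc _ ≤ |‖ψ‖ * (1 - ‖ψ‖) * (q ψ - m)| := le_abs_self _
        _ = |‖ψ‖ * (‖ψ‖ - 1)| * |q ψ - m| := by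
            rw [abs_mul, abs_mul, abs_mul, abs_sub_comm 1]
        _ ≤ _ := mul_le_mul_of_nonneg_left (hbd ψ) (abs_nonneg _)
    have h3 : |‖ψ‖ * (‖ψ‖ - 1)| * B ≤ ε / 8 * ‖ψ‖ ^ 2 + 2 * B ^ 2 / ε * (‖ψ‖ - 1) ^ 2 := by
      rw [abs_mul, abs_norm, ← sq_abs (‖ψ‖ - 1)]
      have h4 : ε / 8 * ‖ψ‖ ^ 2 + 2 * B ^ 2 / ε * |‖ψ‖ - 1| ^ 2 - ‖ψ‖ * |‖ψ‖ - 1| * B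
          = (ε * ‖ψ‖ - 4 * B * |‖ψ‖ - 1|) ^ 2 / (8 * ε) := by
        field_simp
        ring
      have h5 : 0 ≤ (ε * ‖ψ‖ - 4 * B * |‖ψ‖ - 1|) ^ 2 / (8 * ε) := by positivity
      linarith
    nlinarith
  have hi1 : Integrable (fun ψ => ‖ψ‖ ^ 2 * q ψ - m * ‖ψ‖ ^ 2) G := hint.sub (hR2.const_mul _)
  have hi2 : Integrable (fun ψ : H => ε / 8 * ‖ψ‖ ^ 2 + 2 * B ^ 2 / ε * (‖ψ‖ - 1) ^ 2) G :=
    (hR2.const_mul _).add (hR3.const_mul _)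
  have hi3 : Integrable (fun ψ => (‖ψ‖ ^ 2 * q ψ - m * ‖ψ‖ ^ 2)
      + (ε / 8 * ‖ψ‖ ^ 2 + 2 * B ^ 2 / ε * (‖ψ‖ - 1) ^ 2)) G := hi1.add hi2
  have hi0 : Integrable (fun ψ => ‖ψ‖ * (q ψ - (m + ε))) G := by
    refine hR1.mul_bdd (c := B + ε) (by fun_prop) (ae_of_all _ fun ψ => ?_)
    have := abs_le.1 (hbd ψ)
    rw [Real.norm_eq_abs, abs_le]
    constructor <;> linarith
  have hi4 : Integrable (fun ψ => (‖ψ‖ ^ 2 * q ψ - m * ‖ψ‖ ^ 2)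
      + (ε / 8 * ‖ψ‖ ^ 2 + 2 * B ^ 2 / ε * (‖ψ‖ - 1) ^ 2) - ε * ‖ψ‖) G :=
    hi3.sub (hR1.const_mul ε)
  have hle := integral_mono hi0 hi4 hpt
  have heval : ∫ ψ, ((‖ψ‖ ^ 2 * q ψ - m * ‖ψ‖ ^ 2)
      + (ε / 8 * ‖ψ‖ ^ 2 + 2 * B ^ 2 / ε * (‖ψ‖ - 1) ^ 2) - ε * ‖ψ‖) ∂G
      = ε / 8 + 2 * B ^ 2 / ε * ∫ ψ, (‖ψ‖ - 1) ^ 2 ∂G - ε * ∫ ψ, ‖ψ‖ ∂G := by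
    rw [integral_sub hi3 (hR1.const_mul _), integral_add hi1 hi2,
      integral_sub hint (hR2.const_mul _), integral_add (hR2.const_mul _) (hR3.const_mul _),
      integral_const_mul, integral_const_mul, integral_const_mul, integral_const_mul, h2, ← hm]
    ring
  rw [heval] at hle
  refine hle.trans ?_
  have h6 : 2 * B ^ 2 / ε * ∫ ψ, (‖ψ‖ - 1) ^ 2 ∂G ≤ ε / 24 := by
    calc _ ≤ 2 * B ^ 2 / ε * (6 * ‖ρ.op‖) := by gcongr
      _ ≤ ε / 24 := by
        rw [div_mul_eq_mul_div, div_le_iff₀ hε]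
        nlinarith
  -- The assumptions 288B²‖ρ‖ ≤ ε² and ε ≤ B are compatible only for small ‖ρ‖.
  have h7 : ‖ρ.op‖ ≤ 1 / 288 := by
    have : 288 * B ^ 2 * ‖ρ.op‖ ≤ B ^ 2 := hlarge.trans (by gcongr)
    have hB2 : 0 < B ^ 2 := by positivity
    nlinarith
  have h8 : ε * (1 - 3 / 288) ≤ ε * ∫ ψ, ‖ψ‖ ∂G := by
    gcongr
    linarith
  linarith

/-- One-sided deviation bound under the measure with density `‖ψ‖²` relative to `G(ρ)`. -/
theorem setLIntegral_norm_sq_tail_le {f : Metric.sphere (0 : H) 1 → ℝ} {η : ℝ} (hη : 0 < η)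
    (hf : ∀ ψ φ, |f ψ - f φ| ≤ η * sphericalDist ψ φ) (s₀ : Metric.sphere (0 : H) 1) {ε : ℝ}
    (hε : 0 < ε) (hεη : ε ≤ Real.pi * η)
    (hlarge : 288 * (Real.pi * η) ^ 2 * ‖ρ.op‖ ≤ ε ^ 2) :
    ∫⁻ ψ in {ψ | ε < f (toSphere s₀ ψ)
        - ∫ φ, ‖φ‖ ^ 2 * f (toSphere s₀ φ) ∂(gaussianMeasure ρ)},
      ENNReal.ofReal (‖ψ‖ ^ 2) ∂(gaussianMeasure ρ)
      ≤ ENNReal.ofReal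
        (3 * Real.exp (-((1 / (288 * Real.pi ^ 2)) * ε ^ 2 / (η ^ 2 * ‖ρ.op‖)))) := by
  have : SecondCountableTopology H := UniformSpace.secondCountable_of_separable H
  have hP := ρ.norm_pos
  have hpi := Real.pi_pos
  have hfc := continuous_of_sphericalDist hη hf
  have hqm : Measurable fun ψ => f (toSphere s₀ ψ) :=
    hfc.measurable.comp (measurable_toSphere s₀)
  have hosc : ∀ ψ φ : H, |f (toSphere s₀ ψ) - f (toSphere s₀ φ)| ≤ Real.pi * η :=
    fun ψ φ => abs_sub_le_pi_mul hη hf _ _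
  obtain ⟨hint, hbd⟩ := abs_sub_integral_norm_sq_mul_le ρ hqm hosc
  have hmean := integral_norm_mul_sub_le ρ hqm hosc hε hεη hlarge
  have hone : ∫ ψ, ‖ψ‖ ∂(gaussianMeasure ρ) ≤ 1 := by
    have h0 : 0 ≤ ∫ ψ, (‖ψ‖ - 1) ^ 2 ∂(gaussianMeasure ρ) :=
      integral_nonneg fun ψ => by positivity
    rw [integral_norm_sub_sq_gaussianMeasure] at h0
    linarith
  have hnlip : LipschitzWith 1 fun ψ : H => ‖ψ‖ := lipschitzWith_one_norm
  have hnint := hnlip.integrable_gaussianMeasure ρ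
  set m := ∫ φ, ‖φ‖ ^ 2 * f (toSphere s₀ φ) ∂(gaussianMeasure ρ) with hm
  set B := Real.pi * η with hBdef
  have hB0 : 0 < B := by positivity
  set P := ‖ρ.op‖ with hPdef
  have hP288 : P ≤ 1 / 288 := by
    have : 288 * B ^ 2 * P ≤ B ^ 2 := hlarge.trans (by gcongr)
    have hB2 : 0 < B ^ 2 := by positivity
    nlinarith
  -- One B bounds |f - m|, the other bounds ε. Adding πη = B gives the Lipschitz constant 3B of `F`.
  have hbd' : ∀ s, |f s - (m + ε)| ≤ 2 * B := by
    intro s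
    have h1 : |f s - m| ≤ B := by
      have h2 : ∀ x : H, x = s → toSphere s₀ x = s := by
        rintro x rfl
        have hs : (s : H) ≠ 0 := ne_zero_of_mem_unit_sphere s
        refine Subtype.ext ?_
        rw [coe_toSphere s₀ hs]
        simp
      have := hbd (s : H)
      rwa [h2 _ rfl] at this
    have := abs_le.1 h1
    rw [abs_le]
    constructor <;> linarith
  have hFlip := lipschitzWith_norm_mul_comp_toSphere hη hf s₀ hbd'
  set F : H → ℝ := fun ψ => ‖ψ‖ * (f (toSphere s₀ ψ) - (m + ε)) with hF
  have hFint := hFlip.integrable_gaussianMeasure ρ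
  -- The minimiser of -tε/2 + 18B²t²·π²P/16, the part of the exponent below that depends on t.
  set t := 2 * ε / (9 * Real.pi ^ 2 * B ^ 2 * P) with ht
  have ht0 : 0 < t := by positivity
  set K := t * (3 * B) + 2 with hK
  have hΦlip : LipschitzWith K.toNNReal fun ψ : H => t * F ψ + 2 * ‖ψ‖ := by
    refine LipschitzWith.of_dist_le_mul fun ψ φ => ?_
    have h1 := hFlip.dist_le_mul ψ φ
    have h2 := hnlip.dist_le_mul ψ φ
    rw [Real.coe_toNNReal _ (by positivity), Real.dist_eq] at h1 ⊢
    rw [Real.dist_eq, NNReal.coe_one, one_mul] at h2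
    rw [← hBdef] at h1
    calc |t * F ψ + 2 * ‖ψ‖ - (t * F φ + 2 * ‖φ‖)|
        = |t * (F ψ - F φ) + 2 * (‖ψ‖ - ‖φ‖)| := by ring_nf
      _ ≤ t * |F ψ - F φ| + 2 * |‖ψ‖ - ‖φ‖| := by
          refine (abs_add_le _ _).trans (le_of_eq ?_)
          rw [abs_mul, abs_mul, abs_of_pos ht0, abs_two]
      _ ≤ t * ((2 * B + B) * dist ψ φ) + 2 * dist ψ φ := by gcongr
      _ = K * dist ψ φ := by rw [hK]; ring
  have hconc := lintegral_exp_sub_integral_gaussianMeasure_le ρ hΦlip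
  rw [integral_add (hFint.const_mul _) (hnint.const_mul _), integral_const_mul,
    integral_const_mul, Real.coe_toNNReal _ (by positivity)] at hconc
  -- K² is split by (a + b)² ≤ 2a² + 2b². The contribution π²P/2 of the term 2‖ψ‖ is at most 1,
  -- since P ≤ 1/288.
  have hK2 : t * ∫ ψ, F ψ ∂(gaussianMeasure ρ) + K ^ 2 * (Real.pi ^ 2 * P / 16)
      ≤ 1 - (1 / (288 * Real.pi ^ 2)) * ε ^ 2 / (η ^ 2 * P) := by
    have hpi2 : Real.pi ^ 2 < 10 := by nlinarith [Real.pi_lt_d2, Real.pi_gt_three]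
    have h1 : t * ∫ ψ, F ψ ∂(gaussianMeasure ρ) ≤ t * -(ε / 2) :=
      mul_le_mul_of_nonneg_left hmean ht0.le
    have h2 : K ^ 2 ≤ 18 * B ^ 2 * t ^ 2 + 8 := by
      rw [hK]; nlinarith [sq_nonneg (t * (3 * B) - 2)]
    have h3 : K ^ 2 * (Real.pi ^ 2 * P / 16)
        ≤ (18 * B ^ 2 * t ^ 2 + 8) * (Real.pi ^ 2 * P / 16) := by gcongr
    have h4 : t * -(ε / 2) + (18 * B ^ 2 * t ^ 2 + 8) * (Real.pi ^ 2 * P / 16)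
        = -(ε ^ 2 / (18 * Real.pi ^ 2 * B ^ 2 * P)) + Real.pi ^ 2 * P / 2 := by
      rw [ht]
      field_simp
      ring
    -- As B = πη, the optimum has the constant 1/(18π⁴), which exceeds 1/(288π²) because 18π² < 288.
    have h5 : (1 / (288 * Real.pi ^ 2)) * ε ^ 2 / (η ^ 2 * P)
        ≤ ε ^ 2 / (18 * Real.pi ^ 2 * B ^ 2 * P) := by
      have h6 : (1 / (288 * Real.pi ^ 2)) * ε ^ 2 / (η ^ 2 * P)
          = ε ^ 2 / (288 * Real.pi ^ 2 * η ^ 2 * P) := by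
        field_simp
      rw [h6, hBdef]
      refine div_le_div_of_nonneg_left (by positivity) (by positivity) ?_
      have : 18 * Real.pi ^ 2 ≤ 288 := by linarith
      calc 18 * Real.pi ^ 2 * (Real.pi * η) ^ 2 * P
          = 18 * Real.pi ^ 2 * (Real.pi ^ 2 * η ^ 2 * P) := by ring
        _ ≤ 288 * (Real.pi ^ 2 * η ^ 2 * P) := by gcongr
        _ = _ := by ring
    have h7 : Real.pi ^ 2 * P / 2 ≤ 1 := by nlinarith
    linarith
  have hms : MeasurableSet {ψ : H | ε < f (toSphere s₀ ψ) - m} :=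
    measurableSet_lt measurable_const (hqm.sub_const _)
  set c := ∫ ψ, ‖ψ‖ ∂(gaussianMeasure ρ)
  -- On the event F ≥ 0, so the factor exp(tF) may be inserted. Since c ≤ 1, ‖ψ‖ ≤ 1 + ‖ψ‖ - c ≤
  -- exp(‖ψ‖ - c), which bounds the density.
  calc _ ≤ ∫⁻ ψ in {ψ : H | ε < f (toSphere s₀ ψ) - m},
          ENNReal.ofReal (Real.exp (t * F ψ + 2 * ‖ψ‖ - 2 * c)) ∂(gaussianMeasure ρ) := by
        refine setLIntegral_mono' hms fun ψ hψ => ENNReal.ofReal_le_ofReal ?_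
        have hψ' : ε < f (toSphere s₀ ψ) - m := hψ
        have hF0 : 0 ≤ F ψ := mul_nonneg (norm_nonneg _) (by linarith)
        have h1 : ‖ψ‖ ≤ Real.exp (‖ψ‖ - c) := by
          have h2 := Real.add_one_le_exp (‖ψ‖ - c)
          linarith
        calc ‖ψ‖ ^ 2 ≤ Real.exp (‖ψ‖ - c) ^ 2 := by gcongr
          _ = Real.exp (2 * ‖ψ‖ - 2 * c) := by
              rw [sq, ← Real.exp_add]
              ring_nf
          _ ≤ _ := Real.exp_le_exp.2 (by nlinarith)
    _ ≤ ∫⁻ ψ, ENNReal.ofReal (Real.exp (t * F ψ + 2 * ‖ψ‖ - 2 * c)) ∂(gaussianMeasure ρ) :=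
        setLIntegral_le_lintegral _ _
    _ = ENNReal.ofReal (Real.exp (t * ∫ ψ, F ψ ∂(gaussianMeasure ρ))) *
        ∫⁻ ψ, ENNReal.ofReal (Real.exp (t * F ψ + 2 * ‖ψ‖
          - (t * ∫ ψ, F ψ ∂(gaussianMeasure ρ) + 2 * c))) ∂(gaussianMeasure ρ) := by
        rw [← lintegral_const_mul' _ _ ENNReal.ofReal_ne_top]
        refine lintegral_congr fun ψ => ?_
        rw [← ENNReal.ofReal_mul (Real.exp_pos _).le, ← Real.exp_add]
        ring_nf
    _ ≤ ENNReal.ofReal (Real.exp (t * ∫ ψ, F ψ ∂(gaussianMeasure ρ))) *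
        ENNReal.ofReal (Real.exp (K ^ 2 * (Real.pi ^ 2 * P / 16))) := by gcongr
    _ ≤ _ := by
        rw [← ENNReal.ofReal_mul (Real.exp_pos _).le, ← Real.exp_add]
        refine ENNReal.ofReal_le_ofReal ((Real.exp_le_exp.2 hK2).trans ?_)
        rw [sub_eq_add_neg, Real.exp_add]
        have he := Real.exp_one_lt_d9
        gcongr
        linarith

end Tail

/-! ### The two-sided bound. -/

theorem theorem2 {H : Type*} [NormedAddCommGroup H] [InnerProductSpace ℂ H] [CompleteSpace H]
    [TopologicalSpace.SeparableSpace H] [MeasurableSpace H] [BorelSpace H]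
    (ρ : DensityOperator H) (f : Metric.sphere (0 : H) 1 → ℝ) (η : ℝ) (hη : 0 < η)
    (hf : ∀ ψ φ, |f ψ - f φ| ≤ η * sphericalDist ψ φ) (ε : ℝ) (hε : 0 ≤ ε) :
    IsProbabilityMeasure (gapMeasure ρ) ∧
    Integrable f (gapMeasure ρ) ∧
    gapMeasure ρ {ψ | ε < |f ψ - ∫ φ, f φ ∂(gapMeasure ρ)|} ≤
      ENNReal.ofReal
        (6 * Real.exp (-((1 / (288 * Real.pi ^ 2)) * ε ^ 2 / (η ^ 2 * ‖ρ.op‖)))) := by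
  have : SecondCountableTopology H := UniformSpace.secondCountable_of_separable H
  obtain ⟨s₀⟩ := ρ.nonempty_sphere
  have hprob : IsProbabilityMeasure (gapMeasure ρ) := by
    rw [gapMeasure_eq_map_toSphere ρ s₀]
    exact Measure.isProbabilityMeasure_map (measurable_toSphere s₀).aemeasurable
  have hfc := continuous_of_sphericalDist hη hf
  have hosc := abs_sub_le_pi_mul hη hf
  have hint : Integrable f (gapMeasure ρ) := by
    refine Integrable.of_bound hfc.measurable.aestronglyMeasurable (|f s₀| + Real.pi * η)
      (ae_of_all _ fun ψ => ?_)
    have h1 := hosc ψ s₀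
    have h2 := abs_sub_abs_le_abs_sub (f ψ) (f s₀)
    rw [Real.norm_eq_abs]
    linarith
  refine ⟨hprob, hint, ?_⟩
  have hP := ρ.norm_pos
  have hpi := Real.pi_pos
  -- Below this threshold the exponent is at least -1, and 6/e > 1 makes the bound trivial.
  by_cases hsmall : ε ^ 2 ≤ 288 * (Real.pi * η) ^ 2 * ‖ρ.op‖
  · refine prob_le_one.trans ?_
    rw [← ENNReal.ofReal_one]
    refine ENNReal.ofReal_le_ofReal ?_
    have h1 : (1 / (288 * Real.pi ^ 2)) * ε ^ 2 / (η ^ 2 * ‖ρ.op‖) ≤ 1 := by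
      rw [div_le_one (by positivity), one_div, inv_mul_le_iff₀ (by positivity)]
      linarith
    have h2 : Real.exp (-1) ≤
        Real.exp (-((1 / (288 * Real.pi ^ 2)) * ε ^ 2 / (η ^ 2 * ‖ρ.op‖))) :=
      Real.exp_le_exp.2 (by linarith)
    have h3 := Real.exp_neg_one_gt_d9
    linarith
  push Not at hsmall
  have hε0 : 0 < ε := by
    refine hε.lt_of_ne fun h => ?_
    rw [← h] at hsmall
    have : 0 ≤ 288 * (Real.pi * η) ^ 2 * ‖ρ.op‖ := by positivity
    linarith
  set m := ∫ φ, f φ ∂(gapMeasure ρ) with hm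
  have hmeq := integral_gapMeasure ρ s₀ hfc
  rw [← hm] at hmeq
  -- The sphere has diameter π, so `f` never deviates from its mean by more than πη.
  by_cases hbig : Real.pi * η < ε
  · have hempty : {ψ | ε < |f ψ - m|} = ∅ := by
      refine Set.eq_empty_of_forall_notMem fun ψ hψ => ?_
      have h1 : |f ψ - m| ≤ Real.pi * η := by
        have h2 : f ψ - m = ∫ φ, (f ψ - f φ) ∂(gapMeasure ρ) := by
          rw [integral_sub (integrable_const _) hint]
          simp [hm]
        rw [h2, ← Real.norm_eq_abs]
        refine (norm_integral_le_of_norm_le_const (ae_of_all _ fun φ => hosc ψ φ)).trans ?_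
        simp
      exact absurd hψ (by simp only [Set.mem_ofPred_eq]; linarith)
    rw [hempty]
    simp
  push Not at hbig
  have hmeas := hfc.measurable
  -- The tail bound for `-f` controls the lower deviations; two bounds with prefactor 3 add up to 6.
  have hneg : ∀ ψ φ, |(-f) ψ - (-f) φ| ≤ η * sphericalDist ψ φ := fun ψ φ => by
    rw [Pi.neg_apply, Pi.neg_apply, neg_sub_neg, abs_sub_comm]
    exact hf ψ φ
  have h1 := setLIntegral_norm_sq_tail_le ρ hη hf s₀ hε0 hbig hsmall.le
  have h2 := setLIntegral_norm_sq_tail_le ρ hη hneg s₀ hε0 hbig hsmall.le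
  simp only [Pi.neg_apply, mul_neg, integral_neg] at h2
  rw [← hmeq] at h1 h2
  have hsub : {ψ | ε < |f ψ - m|} ⊆ {ψ | ε < f ψ - m} ∪ {ψ | ε < -f ψ - -m} := by
    intro ψ hψ
    have hψ' : ε < |f ψ - m| := hψ
    rcases lt_abs.1 hψ' with h | h
    · exact Or.inl h
    · refine Or.inr ?_
      simp only [Set.mem_ofPred_eq]
      linarith
  refine (measure_mono hsub).trans ((measure_union_le _ _).trans ?_)
  rw [gapMeasure_apply ρ s₀ (measurableSet_lt measurable_const (by fun_prop)),
    gapMeasure_apply ρ s₀ (measurableSet_lt measurable_const (by fun_prop))]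
  refine (add_le_add h1 h2).trans (le_of_eq ?_)
  rw [← ENNReal.ofReal_add (by positivity) (by positivity)]
  congr 1
  ring
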